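/- For $\alpha>0$, $0<r<1$, $\beta\in\mathbb R$ let $$P_{\alpha,r,\beta}(t)=\sum_{k=1}^{\infty}e^{-\alpha k^{r}}\cos\Big(kt-\frac{\beta\pi}{2}\Big),$$ and let $C^{\alpha,r}_{\beta,1}$ be the set of all $2\pi$-periodic functions $f:\mathbb R\to\mathbb R$ that can be written, for all $x\in\mathbb R$, as $$f(x)=\frac{a_0}{2}+\frac1\pi\int_{-\pi}^{\pi}P_{\alpha,r,\beta}(x-t)\varphi(t)\,dt,$$ where $a_0\in\mathbb R$ and $\varphi$ is a $2\pi$-periodic integrable real function with $\|\varphi\|_1\le 1$ and $\int_{-\pi}^{\pi}\varphi(t)\,dt=0$. Here $\|g\|_1=\int_0^{2\pi}|g(t)|\,dt$. For $n\in\mathbb N=\{1,2,\dots\}$ put $$\mathcal E_n(C^{\alpha,r}_{\beta,1})_1=\sup_{f\in C^{\alpha,r}_{\beta,1}}\|f-S_{n-1}(f)\|_1,$$ where $S_{n-1}(f)$ is the partial sum of order $n-1$ of the Fourier series of $f$. Let $n_1(\alpha,r)$ be the least $n\in\mathbb N$ such that $$\frac{1}{\alpha r}\,\frac1{n^{r}}\Big(1+\ln\frac{\pi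 n^{1-r}}{\alpha r}\Big)+\frac{\alpha r}{n^{1-r}}\le\frac1{(3\pi)^3}.$$ **Theorem.** Let $0<r<1$, $\alpha>0$ and $\beta\in\mathbb R$. Then for every $n\ge n_1(\alpha,r)$ the quantity $\mathcal E_n(C^{\alpha,r}_{\beta,1})_1$ is finite and $$\mathcal E_n(C^{\alpha,r}_{\beta,1})_1=\frac4{\pi^2}\,e^{-\alpha n^{r}}\ln\Big(\frac{\pi n^{1-r}}{\alpha r}\Big)+\gamma\,e^{-\alpha n^{r}},$$ where $\gamma=\gamma_n(\alpha,r,\beta)$ satisfies $|\gamma|\le 20\pi^4$. -/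

import Mathlib

open MeasureTheory Filter Topology
open scoped ENNReal

namespace GenPoisson

/-- Lebesgue measure on one period `[0, 2π)`. -/
noncomputable def periodMeasure : Measure ℝ :=
  volume.restrict (Set.Ico 0 (2 * Real.pi))

/-- The norm `‖f‖_s`, `1 ≤ s ≤ ∞`, of a `2π`-periodic function: the `L_s`-norm over `[0, 2π)`
(the essential supremum for `s = ∞`), with values in `[0, ∞]`. -/
noncomputable def periodNorm (s : ℝ≥0∞) (f : ℝ → ℝ) : ℝ≥0∞ :=
  eLpNorm f s periodMeasure

/-- The generalized Poisson kernel
`P_{α,r,β}(t) = ∑_{k ≥ 1} exp (-α k ^ r) cos (k t - β π / 2)`. -/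
noncomputable def kernel (α r β t : ℝ) : ℝ :=
  ∑' k : ℕ, Real.exp (-α * ((k : ℝ) + 1) ^ r) *
    Real.cos (((k : ℝ) + 1) * t - β * Real.pi / 2)

/-- `B_p^0`: the `2π`-periodic functions of the unit ball of `L_p` which are orthogonal to
constants. -/
def zeroMeanBall (p : ℝ≥0∞) : Set (ℝ → ℝ) :=
  {φ | Function.Periodic φ (2 * Real.pi) ∧ AEStronglyMeasurable φ periodMeasure ∧
    periodNorm p φ ≤ 1 ∧ ∫ t in (-Real.pi)..Real.pi, φ t = 0}

/-- `C^{α,r}_{β,p}`: the `2π`-periodic functions that are, at every point, of the form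
`a₀ / 2 + π⁻¹ ∫_{-π}^{π} P_{α,r,β}(x - t) φ(t) dt` with `a₀ ∈ ℝ` and `φ ∈ B_p^0`. -/
def poissonClass (α r β : ℝ) (p : ℝ≥0∞) : Set (ℝ → ℝ) :=
  {f | Function.Periodic f (2 * Real.pi) ∧ ∃ a₀ : ℝ, ∃ φ ∈ zeroMeanBall p, ∀ x : ℝ,
    f x = a₀ / 2 + 1 / Real.pi * ∫ t in (-Real.pi)..Real.pi, kernel α r β (x - t) * φ t}

/-- The cosine Fourier coefficient `a_k(f)`. -/
noncomputable def fourierCos (f : ℝ → ℝ) (k : ℕ) : ℝ :=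
  1 / Real.pi * ∫ t in (-Real.pi)..Real.pi, f t * Real.cos (k * t)

/-- The sine Fourier coefficient `b_k(f)`. -/
noncomputable def fourierSin (f : ℝ → ℝ) (k : ℕ) : ℝ :=
  1 / Real.pi * ∫ t in (-Real.pi)..Real.pi, f t * Real.sin (k * t)

/-- The partial Fourier sum `S_N(f; x)` of order `N`. -/
noncomputable def partialFourierSum (N : ℕ) (f : ℝ → ℝ) (x : ℝ) : ℝ :=
  fourierCos f 0 / 2 +
    ∑ k ∈ Finset.Icc 1 N, (fourierCos f k * Real.cos (k * x) + fourierSin f k * Real.sin (k * x))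

/-- `𝓔_n(C^{α,r}_{β,p})_s = sup {‖f - S_{n-1}(f)‖_s : f ∈ C^{α,r}_{β,p}}` for `n ≥ 1`, as an
element of `[0, ∞]`. -/
noncomputable def fourierError (n : ℕ) (α r β : ℝ) (p s : ℝ≥0∞) : ℝ≥0∞ :=
  ⨆ f ∈ poissonClass α r β p, periodNorm s (fun x => f x - partialFourierSum (n - 1) f x)

/-- The positive integers `n` with
`(α r)⁻¹ n^{-r} (1 + ln (π n^{1-r} / (α r))) + α r / n^{1-r} ≤ (3π)^{-3}`. -/
def admissible (α r : ℝ) : Set ℕ :=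
  {n | 1 ≤ n ∧
    1 / (α * r) * (1 / (n : ℝ) ^ r) *
        (1 + Real.log (Real.pi * (n : ℝ) ^ (1 - r) / (α * r))) +
      α * r / (n : ℝ) ^ (1 - r) ≤ 1 / (3 * Real.pi) ^ 3}

/-- `n₁(α, r)`: the least element of `admissible α r`. -/
noncomputable def n₁ (α r : ℝ) : ℕ := sInf (admissible α r)

/-- For `α > 0` and `0 < r < 1` the number `n₁ α r` really is a least element. -/
theorem isLeast_n₁ {α r : ℝ} (hα : 0 < α) (hr0 : 0 < r) (hr1 : r < 1) :
    IsLeast (admissible α r) (n₁ α r) := by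
  suffices h : (admissible α r).Nonempty from ⟨Nat.sInf_mem h, fun n hn => Nat.sInf_le hn⟩
  have ha : 0 < α * r := mul_pos hα hr0
  have h1 : Tendsto (fun x : ℝ => 1 / x ^ r) atTop (𝓝 0) := by
    simpa [Pi.inv_def] using (tendsto_rpow_atTop hr0).inv_tendsto_atTop
  have h2 : Tendsto (fun x : ℝ => Real.log x / x ^ r) atTop (𝓝 0) :=
    (isLittleO_log_rpow_atTop hr0).tendsto_div_nhds_zero
  have h3 : Tendsto (fun x : ℝ => 1 / x ^ (1 - r)) atTop (𝓝 0) := by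
    simpa [Pi.inv_def] using (tendsto_rpow_atTop (sub_pos.2 hr1)).inv_tendsto_atTop
  have h4 := ((h1.const_mul (1 / (α * r) * (1 + Real.log (Real.pi / (α * r))))).add
    (h2.const_mul (1 / (α * r) * (1 - r)))).add (h3.const_mul (α * r))
  have h5 : (0 : ℝ) < 1 / (3 * Real.pi) ^ 3 := by have := Real.pi_pos; positivity
  simp only [mul_zero, add_zero] at h4
  have h6 := (h4.comp tendsto_natCast_atTop_atTop).eventually (gt_mem_nhds h5)
  obtain ⟨n, hn, hn1⟩ := (h6.and (eventually_ge_atTop 1)).exists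
  refine ⟨n, hn1, le_trans (le_of_eq ?_) hn.le⟩
  have hn0 : (0 : ℝ) < n := by exact_mod_cast hn1
  have hlog : Real.log (Real.pi * (n : ℝ) ^ (1 - r) / (α * r)) =
      Real.log (Real.pi / (α * r)) + (1 - r) * Real.log n := by
    rw [mul_div_right_comm, Real.log_mul (div_pos Real.pi_pos ha).ne'
      (Real.rpow_pos_of_pos hn0 _).ne', Real.log_rpow hn0]
  simp only [Function.comp, hlog]
  ring

end GenPoisson

/-! The remainder `f - S_{n-1}(f)` is `c/π` times the convolution of `φ` with `K(t) = ∑ a_j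
cos((n+j)t - βπ/2)`, where `c = exp(-α n^r)` and `a_j = exp(-α((n+j)^r - n^r))`. Young's inequality
bounds the error by `(c/π)‖K‖₁`. For the converse, the zero mean rules out testing with one point
mass, but smoothed versions of `(δ_0 - δ_π)/2` are allowed and give `(c/2π)‖K - K(· - π)‖₁`. Since
`|K(x)| ≤ 1/|sin(x/2)|`, `K(x)` and `K(x - π)` are never both large, so the two bounds differ by at
most `4c` (`le_fourierError`, `integral_abs_sub_shift_ge`).

It remains to show `‖K‖₁ = (4/π) ln(π/ρ) + O(1)` with `ρ = αr/n^{1-r}`. The `a_j` are convex in `j`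
with `a_0 - a_1 ≤ ρ`, so two summations by parts give `2 sin(t/2) K(t) ≈ -sin((n-1/2)t - θ)` with
error `ρ/|sin(t/2)|`. On `[ρ, π]` this replaces `|K|` by `|sin((n-1/2)t - θ)|/t` at bounded cost,
and the rapidly oscillating `|sin|` may be replaced by its mean `2/π`, which produces the logarithm.
On `[0, ρ]` the bound `|K| ≤ ∑ a_j ≤ 3/ρ` suffices. The negative half of the period is the same with
`-θ`.

The condition `n ≥ n₁` enters only through `αr n^r ≥ 2` and `ρ ≤ 1`. -/

namespace GenPoisson

/-! ### Summation by parts for cosine series with monotone coefficients -/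

/-- The cosine series `∑ a_j cos ((m + j) t - θ)`. -/
noncomputable def shiftedCosSeries (a : ℕ → ℝ) (m θ t : ℝ) : ℝ :=
  ∑' j : ℕ, a j * Real.cos ((m + j) * t - θ)

theorem summable_mul_of_abs_le_one {a u : ℕ → ℝ} (ha : Summable a) (h0 : ∀ j, 0 ≤ a j)
    (hu : ∀ j, |u j| ≤ 1) : Summable fun j => a j * u j := by
  refine Summable.of_norm_bounded ha fun j => ?_
  rw [Real.norm_eq_abs, abs_mul, abs_of_nonneg (h0 j)]
  exact mul_le_of_le_one_right (h0 j) (hu j)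

theorem abs_tsum_mul_le {a u : ℕ → ℝ} (ha : Summable a) (h0 : ∀ j, 0 ≤ a j)
    (hu : ∀ j, |u j| ≤ 1) : |∑' j, a j * u j| ≤ ∑' j, a j := by
  refine tsum_of_norm_bounded (f := fun j => a j * u j) ha.hasSum fun j => ?_
  rw [Real.norm_eq_abs, abs_mul, abs_of_nonneg (h0 j)]
  exact mul_le_of_le_one_right (h0 j) (hu j)

theorem nonneg_of_antitone_summable {a : ℕ → ℝ} (ha : Summable a) (hm : Antitone a) (j : ℕ) :
    0 ≤ a j :=
  hm.le_of_tendsto ha.tendsto_atTop_zero j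

theorem hasSum_sub_succ {a : ℕ → ℝ} (ha : Summable a) :
    HasSum (fun j => a j - a (j + 1)) (a 0) := by
  have h1 : Summable fun j => a (j + 1) := (summable_nat_add_iff 1).2 ha
  have := ha.hasSum.sub h1.hasSum
  rwa [ha.tsum_eq_zero_add, add_sub_cancel_right] at this

/-- Summation by parts. -/
theorem tsum_mul_sub {a u : ℕ → ℝ} (ha : Summable a) (hm : Antitone a) (hu : ∀ j, |u j| ≤ 1) :
    ∑' j, a j * (u (j + 1) - u j) = -(a 0 * u 0) + ∑' j, (a j - a (j + 1)) * u (j + 1) := by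
  have h0 := nonneg_of_antitone_summable ha hm
  have h1 := summable_mul_of_abs_le_one ha h0 hu
  have h2 := summable_mul_of_abs_le_one ha h0 (u := fun j => u (j + 1)) fun j => hu _
  have h3 : Summable fun j => a (j + 1) * u (j + 1) := (summable_nat_add_iff 1).2 h1
  simp only [mul_sub, sub_mul]
  rw [h2.tsum_sub h1, h2.tsum_sub h3, h1.tsum_eq_zero_add]
  ring

theorem abs_tsum_sub_mul_le {a u : ℕ → ℝ} (ha : Summable a) (hm : Antitone a)
    (hu : ∀ j, |u j| ≤ 1) : |∑' j, (a j - a (j + 1)) * u j| ≤ a 0 := by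
  rw [← (hasSum_sub_succ ha).tsum_eq]
  exact abs_tsum_mul_le (hasSum_sub_succ ha).summable (fun j => sub_nonneg.2 (hm j.le_succ)) hu

/-- After summation by parts, the boundary term and the telescoping total variation of `a`
contribute at most `a 0` each. -/
theorem abs_tsum_mul_sub_le {a u : ℕ → ℝ} (ha : Summable a) (hm : Antitone a)
    (hu : ∀ j, |u j| ≤ 1) : |∑' j, a j * (u (j + 1) - u j)| ≤ 2 * a 0 := by
  have h0 := nonneg_of_antitone_summable ha hm 0
  have h1 : |-(a 0 * u 0)| ≤ a 0 := by
    rw [abs_neg, abs_mul, abs_of_nonneg h0]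
    exact mul_le_of_le_one_right h0 (hu 0)
  have h2 := abs_tsum_sub_mul_le (u := fun j => u (j + 1)) ha hm fun j => hu _
  rw [tsum_mul_sub ha hm hu]
  exact (abs_add_le _ _).trans (by linarith)

section

variable {a : ℕ → ℝ} {m θ : ℝ}

/-- The factor `2 sin(t/2)` turns each cosine into a difference of consecutive sines at half-integer
shifts, the form required for summation by parts. -/
theorem two_mul_sin_mul_shiftedCosSeries (t : ℝ) :
    2 * Real.sin (t / 2) * shiftedCosSeries a m θ t =
      ∑' j : ℕ, a j * (Real.sin ((m + (j + 1 : ℕ) - 1 / 2) * t - θ) -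
        Real.sin ((m + j - 1 / 2) * t - θ)) := by
  rw [shiftedCosSeries, ← tsum_mul_left]
  refine tsum_congr fun j => ?_
  rw [Real.sin_sub_sin]
  push_cast
  ring_nf

theorem abs_shiftedCosSeries_le_tsum (ha : Summable a) (hm : Antitone a) (t : ℝ) :
    |shiftedCosSeries a m θ t| ≤ ∑' j, a j :=
  abs_tsum_mul_le ha (nonneg_of_antitone_summable ha hm) fun _ => Real.abs_cos_le_one _

theorem abs_shiftedCosSeries_mul_sin_le (ha : Summable a) (hm : Antitone a) (t : ℝ) :
    |Real.sin (t / 2)| * |shiftedCosSeries a m θ t| ≤ a 0 := by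
  have h := abs_tsum_mul_sub_le ha hm (u := fun j : ℕ => Real.sin ((m + j - 1 / 2) * t - θ))
    fun _ => Real.abs_sin_le_one _
  rw [← two_mul_sin_mul_shiftedCosSeries, abs_mul, abs_mul, abs_two] at h
  linarith

/-- The first summation by parts splits off the boundary term `-a 0 sin((m - 1/2)t - θ)`. Convexity
allows a second one for the remaining sine series, whose coefficients `a j - a (j + 1)` decrease
from `a 0 - a 1`. -/
theorem abs_shiftedCosSeries_add_sin_le (ha : Summable a) (hm : Antitone a)
    (hd : Antitone fun j => a j - a (j + 1)) (t : ℝ) :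
    |Real.sin (t / 2)| *
      |2 * Real.sin (t / 2) * shiftedCosSeries a m θ t + a 0 * Real.sin ((m - 1 / 2) * t - θ)| ≤
      a 0 - a 1 := by
  have h := abs_tsum_mul_sub_le (hasSum_sub_succ ha).summable hd
    (u := fun j : ℕ => Real.cos ((m + j) * t - θ)) fun _ => Real.abs_cos_le_one _
  have e : 2 * Real.sin (t / 2) * shiftedCosSeries a m θ t + a 0 * Real.sin ((m - 1 / 2) * t - θ)
      = ∑' j : ℕ, (a j - a (j + 1)) * Real.sin ((m + (j + 1 : ℕ) - 1 / 2) * t - θ) := by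
    rw [two_mul_sin_mul_shiftedCosSeries, tsum_mul_sub ha hm
      (u := fun j : ℕ => Real.sin ((m + j - 1 / 2) * t - θ)) fun _ => Real.abs_sin_le_one _]
    simp
  have e2 : ∑' j : ℕ, (a j - a (j + 1)) * (Real.cos ((m + (j + 1 : ℕ)) * t - θ) -
      Real.cos ((m + j) * t - θ)) = -(2 * Real.sin (t / 2)) *
        ∑' j : ℕ, (a j - a (j + 1)) * Real.sin ((m + (j + 1 : ℕ) - 1 / 2) * t - θ) := by
    rw [← tsum_mul_left]
    refine tsum_congr fun j => ?_
    rw [Real.cos_sub_cos]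
    push_cast
    ring_nf
  rw [e2, abs_mul, abs_neg, abs_mul, abs_two] at h
  rw [e]
  simp only [zero_add] at h
  linarith

theorem continuous_shiftedCosSeries (ha : Summable a) (hm : Antitone a) :
    Continuous (shiftedCosSeries a m θ) := by
  have h0 := nonneg_of_antitone_summable ha hm
  refine continuous_tsum (fun j => by fun_prop) ha fun j t => ?_
  rw [Real.norm_eq_abs, abs_mul, abs_of_nonneg (h0 j)]
  exact mul_le_of_le_one_right (h0 j) (Real.abs_cos_le_one _)

theorem shiftedCosSeries_neg (t : ℝ) :
    shiftedCosSeries a m θ (-t) = shiftedCosSeries a m (-θ) t := by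
  refine tsum_congr fun j => ?_
  rw [← Real.cos_neg]
  ring_nf

theorem periodic_shiftedCosSeries (n : ℕ) :
    Function.Periodic (shiftedCosSeries a n θ) (2 * Real.pi) := by
  intro t
  refine tsum_congr fun j => ?_
  have : ((n : ℝ) + j) * (t + 2 * Real.pi) - θ =
      ((n : ℝ) + j) * t - θ + ((n + j : ℕ) : ℝ) * (2 * Real.pi) := by push_cast; ring
  rw [this, Real.cos_add_nat_mul_two_pi]

end

/-! ### The `L₁`-norm of a cosine series with convex coefficients -/

/-- The primitive of `|sin| - 2 / π`, the mean-zero part of `|sin|`. -/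
noncomputable def absSinPrimitive (x : ℝ) : ℝ :=
  ∫ v in (0 : ℝ)..x, (|Real.sin v| - 2 / Real.pi)

theorem continuous_abs_sin_sub : Continuous fun v : ℝ => |Real.sin v| - 2 / Real.pi := by
  fun_prop

theorem hasDerivAt_absSinPrimitive (x : ℝ) :
    HasDerivAt absSinPrimitive (|Real.sin x| - 2 / Real.pi) x :=
  (continuous_abs_sin_sub.integral_hasStrictDerivAt 0 x).hasDerivAt

theorem integral_abs_sin_sub_eq_zero :
    ∫ v in (0 : ℝ)..Real.pi, (|Real.sin v| - 2 / Real.pi) = 0 := by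
  have h : ∫ v in (0 : ℝ)..Real.pi, |Real.sin v| = ∫ v in (0 : ℝ)..Real.pi, Real.sin v := by
    refine intervalIntegral.integral_congr fun v hv => ?_
    rw [Set.uIcc_of_le Real.pi_pos.le] at hv
    exact abs_of_nonneg (Real.sin_nonneg_of_mem_Icc hv)
  have hc : Continuous fun v : ℝ => |Real.sin v| := by fun_prop
  rw [intervalIntegral.integral_sub (hc.intervalIntegrable _ _)
    (continuous_const.intervalIntegrable _ _), h, integral_sin, intervalIntegral.integral_const]
  have := Real.pi_pos.ne'
  simp only [Real.cos_zero, Real.cos_pi, smul_eq_mul]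
  field_simp
  ring

theorem periodic_absSinPrimitive : Function.Periodic absSinPrimitive Real.pi := by
  intro x
  have hp : Function.Periodic (fun v : ℝ => |Real.sin v| - 2 / Real.pi) Real.pi := by
    intro v
    simp [Real.sin_add_pi]
  have h := hp.intervalIntegral_add_eq x 0
  rw [zero_add, integral_abs_sin_sub_eq_zero] at h
  have h2 := intervalIntegral.integral_add_adjacent_intervals
    (continuous_abs_sin_sub.intervalIntegrable (μ := volume) 0 x)
    (continuous_abs_sin_sub.intervalIntegrable x (x + Real.pi))
  rw [h, add_zero] at h2
  exact h2.symm

theorem abs_absSinPrimitive_le (x : ℝ) : |absSinPrimitive x| ≤ Real.pi := by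
  obtain ⟨y, hy, hxy⟩ := periodic_absSinPrimitive.exists_mem_Ico₀ Real.pi_pos x
  rw [hxy]
  have h := intervalIntegral.norm_integral_le_of_norm_le_const (a := 0) (b := y) (C := 1)
    (f := fun v : ℝ => |Real.sin v| - 2 / Real.pi) fun v _ => by
      have h1 := abs_nonneg (Real.sin v)
      have h2 := Real.abs_sin_le_one v
      have h3 : 0 < 2 / Real.pi := by have := Real.pi_pos; positivity
      have h4 : 2 / Real.pi ≤ 1 := by
        rw [div_le_one Real.pi_pos]; exact Real.two_le_pi
      rw [Real.norm_eq_abs, abs_le]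
      constructor <;> linarith
  rw [sub_zero, abs_of_nonneg hy.1, one_mul] at h
  exact h.trans hy.2.le

theorem continuousOn_inv_Icc {x y : ℝ} (hx : 0 < x) :
    ContinuousOn (fun t : ℝ => t⁻¹) (Set.Icc x y) :=
  continuousOn_inv₀.mono fun _ ht => (hx.trans_le ht.1).ne'

theorem integral_inv_sq {x y : ℝ} (hx : 0 < x) (hxy : x ≤ y) :
    ∫ t in x..y, (t ^ 2)⁻¹ = x⁻¹ - y⁻¹ := by
  have h : ∀ t ∈ Set.uIcc x y, HasDerivAt (fun t : ℝ => -t⁻¹) (t ^ 2)⁻¹ t := by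
    intro t ht
    rw [Set.uIcc_of_le hxy] at ht
    simpa only [neg_neg] using (hasDerivAt_inv (hx.trans_le ht.1).ne').fun_neg
  have hc : ContinuousOn (fun t : ℝ => (t ^ 2)⁻¹) (Set.uIcc x y) := by
    rw [Set.uIcc_of_le hxy]
    exact ContinuousOn.inv₀ (by fun_prop) fun t ht => (pow_pos (hx.trans_le ht.1) 2).ne'
  rw [intervalIntegral.integral_eq_sub_of_hasDerivAt h hc.intervalIntegrable]
  ring

/-- The mean value of `|sin|` against the slowly varying weight `1 / t`. -/
theorem abs_integral_abs_sin_sub_div_le {x y w θ : ℝ} (hx : 0 < x) (hxy : x ≤ y) (hw : 0 < w) :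
    |∫ t in x..y, (|Real.sin (w * t - θ)| - 2 / Real.pi) * t⁻¹| ≤ 2 * Real.pi / (w * x) := by
  have hy : 0 < y := hx.trans_le hxy
  have hpi := Real.pi_pos
  have hu : ∀ t ∈ Set.uIcc x y, HasDerivAt (fun t : ℝ => t⁻¹) (-(t ^ 2)⁻¹) t := by
    intro t ht
    rw [Set.uIcc_of_le hxy] at ht
    exact hasDerivAt_inv (hx.trans_le ht.1).ne'
  have hv : ∀ t ∈ Set.uIcc x y, HasDerivAt (fun t : ℝ => absSinPrimitive (w * t - θ) / w)
      (|Real.sin (w * t - θ)| - 2 / Real.pi) t := by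
    intro t _
    have h1 : HasDerivAt (fun t : ℝ => w * t - θ) w t := by
      simpa using ((hasDerivAt_id t).const_mul w).sub_const θ
    have h2 := ((hasDerivAt_absSinPrimitive (w * t - θ)).comp t h1).div_const w
    rw [mul_div_cancel_right₀ _ hw.ne'] at h2
    exact h2
  have hc : ContinuousOn (fun t : ℝ => (t ^ 2)⁻¹) (Set.uIcc x y) := by
    rw [Set.uIcc_of_le hxy]
    exact ContinuousOn.inv₀ (by fun_prop) fun t ht => (pow_pos (hx.trans_le ht.1) 2).ne'
  have hg : Continuous fun t : ℝ => |Real.sin (w * t - θ)| - 2 / Real.pi := by fun_prop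
  -- Integration by parts: the mean-zero factor has a primitive bounded by `π / w`, and the
  -- derivative falls on `1 / t`.
  have h := intervalIntegral.integral_mul_deriv_eq_deriv_mul hu hv hc.neg.intervalIntegrable
    (hg.intervalIntegrable _ _)
  have hb : ∀ t, |absSinPrimitive (w * t - θ) / w| ≤ Real.pi / w := fun t => by
    rw [abs_div, abs_of_pos hw]
    exact div_le_div_of_nonneg_right (abs_absSinPrimitive_le _) hw.le
  have hI : |∫ t in x..y, -(t ^ 2)⁻¹ * (absSinPrimitive (w * t - θ) / w)| ≤
      (x⁻¹ - y⁻¹) * (Real.pi / w) := by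
    rw [← integral_inv_sq hx hxy, ← intervalIntegral.integral_mul_const, ← Real.norm_eq_abs]
    refine intervalIntegral.norm_integral_le_of_norm_le hxy
      (Filter.Eventually.of_forall fun t _ => ?_) (hc.intervalIntegrable.mul_const _)
    rw [Real.norm_eq_abs, abs_mul, abs_neg, abs_of_nonneg (by positivity : 0 ≤ (t ^ 2)⁻¹)]
    exact mul_le_mul_of_nonneg_left (hb t) (by positivity)
  have h1 : |y⁻¹ * (absSinPrimitive (w * y - θ) / w)| ≤ y⁻¹ * (Real.pi / w) := by
    rw [abs_mul, abs_of_pos (inv_pos.2 hy)]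
    exact mul_le_mul_of_nonneg_left (hb y) (by positivity)
  have h2 : |x⁻¹ * (absSinPrimitive (w * x - θ) / w)| ≤ x⁻¹ * (Real.pi / w) := by
    rw [abs_mul, abs_of_pos (inv_pos.2 hx)]
    exact mul_le_mul_of_nonneg_left (hb x) (by positivity)
  -- The two boundary terms and the integral add up to `(y⁻¹ + x⁻¹ + (x⁻¹ - y⁻¹)) π / w`.
  have e : 2 * Real.pi / (w * x) = 2 * (x⁻¹ * (Real.pi / w)) := by
    field_simp
  simp only [mul_comm _ (_⁻¹ : ℝ)]
  rw [h, e]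
  rw [abs_le] at *
  constructor <;> linarith

theorem div_pi_le_sin_half {t : ℝ} (h0 : 0 ≤ t) (h1 : t ≤ Real.pi) :
    t / Real.pi ≤ Real.sin (t / 2) := by
  have h := Real.mul_le_sin (x := t / 2) (by linarith) (by linarith)
  calc t / Real.pi = 2 / Real.pi * (t / 2) := by ring
    _ ≤ _ := h

/-- The singularities at `0` cancel: over a common denominator the numerator is `O(t³)`, the
denominator of order `t²`. -/
theorem inv_two_mul_sin_half_sub_inv_mem {t : ℝ} (h0 : 0 < t) (h1 : t ≤ Real.pi) :
    (2 * Real.sin (t / 2))⁻¹ - t⁻¹ ∈ Set.Icc (0 : ℝ) 1 := by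
  have hpi := Real.pi_pos
  have hs := div_pi_le_sin_half h0.le h1
  have hs0 : 0 < Real.sin (t / 2) := (by positivity : 0 < t / Real.pi).trans_le hs
  have hlt := Real.sin_lt (x := t / 2) (by linarith)
  have hcub := Real.sin_ge_sub_cube (x := t / 2) (by linarith)
  have e : (2 * Real.sin (t / 2))⁻¹ - t⁻¹ =
      (t - 2 * Real.sin (t / 2)) / (2 * Real.sin (t / 2) * t) := by
    field_simp
  rw [e]
  refine ⟨div_nonneg (by linarith) (by positivity), ?_⟩
  rw [div_le_one (by positivity)]
  have h2 : 2 * (t / Real.pi) * t ≤ 2 * Real.sin (t / 2) * t := by gcongr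
  refine le_trans ?_ h2
  have h3 : t / 4 ≤ 1 := by linarith [Real.pi_le_four]
  have h4 : t / 4 * t ^ 2 ≤ 1 * t ^ 2 := by gcongr
  have h5 : t ^ 2 / 4 ≤ t ^ 2 / Real.pi := by gcongr; exact Real.pi_le_four
  have h6 : 2 * (t / Real.pi) * t = 2 * (t ^ 2 / Real.pi) := by ring
  rw [h6]
  nlinarith

section

variable {a : ℕ → ℝ} {m θ ρ : ℝ}

/-- Dividing the twice-summed estimate by `2 sin(t/2)` leaves an error `ρ / (2 sin²(t/2))`, which
Jordan's inequality bounds by a multiple of `ρ / t²`. Replacing `1 / (2 sin(t/2))` by `1 / t` costs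
at most `1`. -/
theorem abs_abs_shiftedCosSeries_sub_le (ha : Summable a) (hm : Antitone a)
    (hd : Antitone fun j => a j - a (j + 1)) (ha0 : a 0 = 1) (hρ : a 0 - a 1 ≤ ρ) {t : ℝ}
    (h0 : 0 < t) (h1 : t ≤ Real.pi) :
    |(|shiftedCosSeries a m θ t| - |Real.sin ((m - 1 / 2) * t - θ)| * t⁻¹)| ≤
      Real.pi ^ 2 / 2 * ρ * (t ^ 2)⁻¹ + 1 := by
  have hpi := Real.pi_pos
  have hs := div_pi_le_sin_half h0.le h1
  have hs0 : 0 < Real.sin (t / 2) := (by positivity : 0 < t / Real.pi).trans_le hs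
  have hρ0 : 0 ≤ ρ := (sub_nonneg.2 (hm zero_le_one)).trans hρ
  have h := (abs_shiftedCosSeries_add_sin_le (m := m) (θ := θ) ha hm hd t).trans hρ
  obtain ⟨hi0, hi1⟩ := inv_two_mul_sin_half_sub_inv_mem h0 h1
  set K := shiftedCosSeries a m θ t
  set S := Real.sin ((m - 1 / 2) * t - θ) with hS
  set s := Real.sin (t / 2)
  rw [ha0, one_mul, abs_of_pos hs0] at h
  have hS1 : |S| ≤ 1 := Real.abs_sin_le_one _
  have h2 : |(|K| - |S| * (2 * s)⁻¹)| ≤ Real.pi ^ 2 / 2 * ρ * (t ^ 2)⁻¹ := by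
    have h3 : |(|K| - |S| * (2 * s)⁻¹)| ≤ |2 * s * K + S| * (2 * s)⁻¹ := by
      have e1 : |K| = |2 * s * K| * (2 * s)⁻¹ := by
        rw [abs_mul, abs_of_pos (by positivity : 0 < 2 * s)]; field_simp
      rw [e1, ← sub_mul, abs_mul, abs_of_pos (by positivity : 0 < (2 * s)⁻¹)]
      have := abs_abs_sub_abs_le_abs_sub (2 * s * K) (-S)
      rw [abs_neg, sub_neg_eq_add] at this
      gcongr
    refine h3.trans ?_
    have h4 : |2 * s * K + S| ≤ ρ / s := by rw [le_div_iff₀' hs0]; exact h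
    calc |2 * s * K + S| * (2 * s)⁻¹ ≤ ρ / s * (2 * s)⁻¹ := by gcongr
      _ = ρ / 2 * (s ^ 2)⁻¹ := by field_simp
      _ ≤ ρ / 2 * ((t / Real.pi) ^ 2)⁻¹ := by gcongr
      _ = _ := by field_simp
  have h5 : |(|S| * ((2 * s)⁻¹ - t⁻¹))| ≤ 1 := by
    rw [abs_mul, abs_abs, abs_of_nonneg hi0]
    exact mul_le_one₀ hS1 hi0 hi1
  calc |(|K| - |S| * t⁻¹)| = |(|K| - |S| * (2 * s)⁻¹ + |S| * ((2 * s)⁻¹ - t⁻¹))| := by ring_nf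
    _ ≤ _ := (abs_add_le _ _).trans (add_le_add h2 h5)

/-- The interval is split at `ρ`, where the bound `3 / ρ` integrates to `3` on the left and the
error `ρ / t²` still integrates to `O(1)` on the right. The hypothesis `hw` keeps the oscillation
error below `2π`. -/
theorem abs_integral_zero_pi_abs_shiftedCosSeries_sub_le (ha : Summable a) (hm : Antitone a)
    (hd : Antitone fun j => a j - a (j + 1)) (ha0 : a 0 = 1) (hρ : a 0 - a 1 ≤ ρ)
    (hρ0 : 0 < ρ) (hρ1 : ρ ≤ 1) (hsum : ∑' j, a j ≤ 3 / ρ) (hw : 1 ≤ (m - 1 / 2) * ρ) :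
    |(∫ t in (0 : ℝ)..Real.pi, |shiftedCosSeries a m θ t|) -
      2 / Real.pi * Real.log (Real.pi / ρ)| ≤ 18 := by
  have hpi := Real.pi_pos
  have hρpi : ρ ≤ Real.pi := hρ1.trans (by linarith [Real.two_le_pi])
  have hw0 : 0 < m - 1 / 2 := pos_of_mul_pos_left (zero_lt_one.trans_le hw) hρ0.le
  have hK : Continuous fun t => |shiftedCosSeries a m θ t| :=
    (continuous_shiftedCosSeries ha hm).abs
  have hinv : ContinuousOn (fun t : ℝ => t⁻¹) (Set.uIcc ρ Real.pi) := by
    rw [Set.uIcc_of_le hρpi]; exact continuousOn_inv_Icc hρ0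
  have hinv2 : ContinuousOn (fun t : ℝ => (t ^ 2)⁻¹) (Set.uIcc ρ Real.pi) := by
    rw [Set.uIcc_of_le hρpi]
    exact ContinuousOn.inv₀ (by fun_prop) fun t ht => (pow_pos (hρ0.trans_le ht.1) 2).ne'
  have hsin : Continuous fun t : ℝ => |Real.sin ((m - 1 / 2) * t - θ)| := by fun_prop
  have hS : ContinuousOn (fun t : ℝ => |Real.sin ((m - 1 / 2) * t - θ)| * t⁻¹)
      (Set.uIcc ρ Real.pi) := hsin.continuousOn.mul hinv
  have hS2 : ContinuousOn (fun t : ℝ =>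
      (|Real.sin ((m - 1 / 2) * t - θ)| - 2 / Real.pi) * t⁻¹) (Set.uIcc ρ Real.pi) :=
    ContinuousOn.mul (by fun_prop) hinv
  have hlog : ∫ t in ρ..Real.pi, 2 / Real.pi * t⁻¹ = 2 / Real.pi * Real.log (Real.pi / ρ) := by
    rw [intervalIntegral.integral_const_mul, integral_inv_of_pos hρ0 hpi]
  have h1 : |(∫ t in (0 : ℝ)..ρ, |shiftedCosSeries a m θ t|)| ≤ 3 := by
    have := intervalIntegral.norm_integral_le_of_norm_le_const (a := 0) (b := ρ) (C := 3 / ρ)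
      (f := fun t => |shiftedCosSeries a m θ t|) fun t _ => by
        rw [Real.norm_eq_abs, abs_abs]
        exact (abs_shiftedCosSeries_le_tsum ha hm t).trans hsum
    rwa [sub_zero, abs_of_pos hρ0, div_mul_cancel₀ _ hρ0.ne'] at this
  have h2 : |∫ t in ρ..Real.pi,
      (|shiftedCosSeries a m θ t| - |Real.sin ((m - 1 / 2) * t - θ)| * t⁻¹)| ≤
      Real.pi ^ 2 / 2 + Real.pi := by
    have hb := intervalIntegral.norm_integral_le_of_norm_le (μ := volume) hρpi
      (f := fun t => |shiftedCosSeries a m θ t| - |Real.sin ((m - 1 / 2) * t - θ)| * t⁻¹)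
      (g := fun t => Real.pi ^ 2 / 2 * ρ * (t ^ 2)⁻¹ + 1)
      (Filter.Eventually.of_forall fun t ht =>
        abs_abs_shiftedCosSeries_sub_le ha hm hd ha0 hρ (hρ0.trans ht.1) ht.2)
      ((hinv2.intervalIntegrable.const_mul _).add (intervalIntegrable_const))
    rw [intervalIntegral.integral_add (hinv2.intervalIntegrable.const_mul _)
      (continuous_const.intervalIntegrable _ _), intervalIntegral.integral_const_mul,
      integral_inv_sq hρ0 hρpi, intervalIntegral.integral_const, smul_eq_mul, mul_one] at hb
    refine hb.trans ?_
    have e : Real.pi ^ 2 / 2 * ρ * (ρ⁻¹ - Real.pi⁻¹) = Real.pi ^ 2 / 2 - Real.pi / 2 * ρ := by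
      field_simp
    rw [e]
    nlinarith
  have h3 := abs_integral_abs_sin_sub_div_le (θ := θ) hρ0 hρpi hw0
  have h4 : 2 * Real.pi / ((m - 1 / 2) * ρ) ≤ 2 * Real.pi := div_le_self (by positivity) hw
  have e1 : (∫ t in (0 : ℝ)..Real.pi, |shiftedCosSeries a m θ t|) -
      2 / Real.pi * Real.log (Real.pi / ρ) =
      (∫ t in (0 : ℝ)..ρ, |shiftedCosSeries a m θ t|) +
      (∫ t in ρ..Real.pi,
        (|shiftedCosSeries a m θ t| - |Real.sin ((m - 1 / 2) * t - θ)| * t⁻¹)) +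
      ∫ t in ρ..Real.pi, (|Real.sin ((m - 1 / 2) * t - θ)| - 2 / Real.pi) * t⁻¹ := by
    rw [← intervalIntegral.integral_add_adjacent_intervals (hK.intervalIntegrable 0 ρ)
      (hK.intervalIntegrable ρ Real.pi), ← hlog, add_assoc, add_sub_assoc,
      ← intervalIntegral.integral_add
        ((hK.intervalIntegrable _ _).sub hS.intervalIntegrable) hS2.intervalIntegrable,
      ← intervalIntegral.integral_sub (hK.intervalIntegrable _ _)
        (hinv.intervalIntegrable.const_mul _)]
    congr 2
    funext t
    ring
  rw [e1]
  -- The three contributions sum to `3 + (π²/2 + π) + 2π < 18`.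
  have hpi4 : Real.pi ≤ 3.15 := Real.pi_lt_d2.le
  have h5 : Real.pi ^ 2 ≤ 10 := by nlinarith
  rw [abs_le] at *
  constructor <;> linarith

/-- The `L₁`-norm over a period of a cosine series with convex coefficients. -/
theorem abs_integral_abs_shiftedCosSeries_sub_le (ha : Summable a) (hm : Antitone a)
    (hd : Antitone fun j => a j - a (j + 1)) (ha0 : a 0 = 1) (hρ : a 0 - a 1 ≤ ρ)
    (hρ0 : 0 < ρ) (hρ1 : ρ ≤ 1) (hsum : ∑' j, a j ≤ 3 / ρ) (hw : 1 ≤ (m - 1 / 2) * ρ) :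
    |(∫ t in (-Real.pi)..Real.pi, |shiftedCosSeries a m θ t|) -
      4 / Real.pi * Real.log (Real.pi / ρ)| ≤ 36 := by
  have hK : Continuous fun t => |shiftedCosSeries a m θ t| :=
    (continuous_shiftedCosSeries ha hm).abs
  have h1 := abs_integral_zero_pi_abs_shiftedCosSeries_sub_le (θ := θ) ha hm hd ha0 hρ hρ0 hρ1
    hsum hw
  have h2 := abs_integral_zero_pi_abs_shiftedCosSeries_sub_le (θ := -θ) ha hm hd ha0 hρ hρ0 hρ1
    hsum hw
  -- Reflection only changes the sign of the phase, and the half-period estimate is uniform in the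
  -- phase.
  have e : ∫ t in (-Real.pi)..0, |shiftedCosSeries a m θ t| =
      ∫ t in (0 : ℝ)..Real.pi, |shiftedCosSeries a m (-θ) t| := by
    simp only [← shiftedCosSeries_neg]
    rw [intervalIntegral.integral_comp_neg (fun t => |shiftedCosSeries a m θ t|), neg_zero]
  rw [← intervalIntegral.integral_add_adjacent_intervals (hK.intervalIntegrable (-Real.pi) 0)
    (hK.intervalIntegrable 0 Real.pi), e]
  have e2 : 4 / Real.pi * Real.log (Real.pi / ρ) =
    2 * (2 / Real.pi * Real.log (Real.pi / ρ)) := by ring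
  rw [e2]
  rw [abs_le] at *
  constructor <;> linarith

end

/-! ### The coefficients of the generalized Poisson kernel -/

/-- The coefficients `exp (-α (n + j) ^ r)`, normalised to take the value `1` at `j = 0`. -/
noncomputable def normalizedCoeff (α r : ℝ) (n j : ℕ) : ℝ :=
  Real.exp (-α * (((n : ℝ) + j) ^ r - (n : ℝ) ^ r))

section

variable {α r : ℝ} {n : ℕ}

theorem normalizedCoeff_zero : normalizedCoeff α r n 0 = 1 := by
  simp [normalizedCoeff]

theorem normalizedCoeff_pos (j : ℕ) : 0 < normalizedCoeff α r n j := Real.exp_pos _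

theorem antitone_normalizedCoeff (hα : 0 ≤ α) (hr0 : 0 ≤ r) :
    Antitone (normalizedCoeff α r n) := by
  intro i j hij
  have h : ((n : ℝ) + i) ^ r ≤ ((n : ℝ) + j) ^ r :=
    Real.rpow_le_rpow (by positivity) (by gcongr) hr0
  refine Real.exp_le_exp.2 ?_
  nlinarith

/-- The map `x ↦ exp(-α x^r)` is convex, since `x^r` is concave and `exp` is convex and increasing;
its midpoint inequality is the claim. -/
theorem antitone_normalizedCoeff_sub (hα : 0 ≤ α) (hr0 : 0 ≤ r) (hr1 : r ≤ 1) :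
    Antitone fun j => normalizedCoeff α r n j - normalizedCoeff α r n (j + 1) := by
  refine antitone_nat_of_succ_le fun j => ?_
  have hx : (n : ℝ) + j ∈ Set.Ici (0 : ℝ) := by simp only [Set.mem_Ici]; positivity
  have hy : (n : ℝ) + j + 2 ∈ Set.Ici (0 : ℝ) := by simp only [Set.mem_Ici]; positivity
  have hh : (0 : ℝ) ≤ 1 / 2 := by norm_num
  have hconc := (Real.concaveOn_rpow hr0 hr1).2 hx hy hh hh (by norm_num)
  simp only [smul_eq_mul] at hconc
  have e : (1 : ℝ) / 2 * (n + j) + 1 / 2 * (n + j + 2) = n + (j + 1 : ℕ) := by push_cast; ring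
  rw [e] at hconc
  have hexp := convexOn_exp.2 (Set.mem_univ (-α * (((n : ℝ) + j) ^ r - (n : ℝ) ^ r)))
    (Set.mem_univ (-α * (((n : ℝ) + j + 2) ^ r - (n : ℝ) ^ r))) hh hh (by norm_num)
  simp only [smul_eq_mul] at hexp
  have hle : normalizedCoeff α r n (j + 1) ≤
      Real.exp (1 / 2 * (-α * (((n : ℝ) + j) ^ r - (n : ℝ) ^ r)) +
        1 / 2 * (-α * (((n : ℝ) + j + 2) ^ r - (n : ℝ) ^ r))) := by
    refine Real.exp_le_exp.2 ?_
    nlinarith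
  have e2 : normalizedCoeff α r n (j + 1 + 1) =
      Real.exp (-α * (((n : ℝ) + j + 2) ^ r - (n : ℝ) ^ r)) := by
    rw [normalizedCoeff]
    push_cast
    ring_nf
  have e3 : normalizedCoeff α r n j = Real.exp (-α * (((n : ℝ) + j) ^ r - (n : ℝ) ^ r)) := rfl
  rw [← e2, ← e3] at hexp
  linarith

/-- Combines `1 - exp(-x) ≤ x` with Bernoulli's inequality `(1 + 1/n)^r ≤ 1 + r/n`. -/
theorem normalizedCoeff_zero_sub_one_le (hα : 0 ≤ α) (hr0 : 0 ≤ r) (hr1 : r ≤ 1) (hn : 0 < n) :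
    normalizedCoeff α r n 0 - normalizedCoeff α r n 1 ≤ α * r / (n : ℝ) ^ (1 - r) := by
  have hn0 : (0 : ℝ) < n := by exact_mod_cast hn
  have h1 := Real.add_one_le_exp (-α * (((n : ℝ) + (1 : ℕ)) ^ r - (n : ℝ) ^ r))
  have h2 := rpow_one_add_le_one_add_mul_self (s := 1 / (n : ℝ)) (p := r)
    (by have : 0 < 1 / (n : ℝ) := by positivity
        linarith) hr0 hr1
  have h3 : ((n : ℝ) + (1 : ℕ)) ^ r = (n : ℝ) ^ r * (1 + 1 / (n : ℝ)) ^ r := by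
    rw [← Real.mul_rpow hn0.le (by positivity)]
    congr 1
    push_cast
    field_simp
  have h4 : α * r / (n : ℝ) ^ (1 - r) = α * ((n : ℝ) ^ r * (r * (1 / n))) := by
    rw [Real.rpow_sub hn0, Real.rpow_one]
    field_simp
  rw [normalizedCoeff_zero, normalizedCoeff, h4]
  rw [h3] at h1 ⊢
  have h5 : (n : ℝ) ^ r * (1 + 1 / (n : ℝ)) ^ r ≤ (n : ℝ) ^ r * (1 + r * (1 / n)) := by gcongr
  nlinarith

/-- The decay of consecutive coefficients. -/
theorem add_mul_normalizedCoeff_succ_le (hα : 0 ≤ α) (hr0 : 0 ≤ r) (hn : 0 < n)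
    (hB : 1 ≤ α * r * (n : ℝ) ^ r) (j : ℕ) :
    ((n : ℝ) + j + α * r * (n : ℝ) ^ r) * normalizedCoeff α r n (j + 1) ≤
      ((n : ℝ) + j) * normalizedCoeff α r n j := by
  have hn0 : (0 : ℝ) < n := by exact_mod_cast hn
  set B := α * r * (n : ℝ) ^ r with hBdef
  set x : ℝ := (n : ℝ) + j with hx
  have hx0 : 0 < x := by positivity
  have hbern := one_add_mul_self_le_rpow_one_add (s := 1 / x) (p := B)
    (by have : 0 < 1 / x := by positivity
        linarith) hB
  have h1x : 0 < 1 + 1 / x := by positivity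
  have hlog0 : 0 ≤ Real.log (1 + 1 / x) := Real.log_nonneg (by
    have : 0 < 1 / x := by positivity
    linarith)
  have h3 : (x + 1) ^ r = x ^ r * (1 + 1 / x) ^ r := by
    rw [← Real.mul_rpow hx0.le h1x.le]
    congr 1
    field_simp
  have h4 : 1 + r * Real.log (1 + 1 / x) ≤ (1 + 1 / x) ^ r := by
    rw [Real.rpow_def_of_pos h1x]
    have := Real.add_one_le_exp (Real.log (1 + 1 / x) * r)
    linarith
  have h5 : (n : ℝ) ^ r ≤ x ^ r := Real.rpow_le_rpow hn0.le (by simp [hx]) hr0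
  -- The coefficients decay at least as fast as the power `x^(-B)`; Bernoulli's inequality with
  -- exponent `B ≥ 1` then makes the ratio of consecutive coefficients at least `1 + B / x`.
  have h6 : Real.log (1 + 1 / x) * B ≤ α * ((x + 1) ^ r - x ^ r) := by
    calc Real.log (1 + 1 / x) * B = α * ((n : ℝ) ^ r * (r * Real.log (1 + 1 / x))) := by
          rw [hBdef]; ring
      _ ≤ α * (x ^ r * (r * Real.log (1 + 1 / x))) := by gcongr
      _ ≤ α * (x ^ r * ((1 + 1 / x) ^ r - 1)) := by gcongr; linarith
      _ = _ := by rw [h3]; ring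
  have h7 : 1 + B * (1 / x) ≤ Real.exp (α * ((x + 1) ^ r - x ^ r)) := by
    refine hbern.trans ?_
    rw [Real.rpow_def_of_pos h1x]
    exact Real.exp_le_exp.2 h6
  have h8 : normalizedCoeff α r n j =
      Real.exp (α * ((x + 1) ^ r - x ^ r)) * normalizedCoeff α r n (j + 1) := by
    rw [normalizedCoeff, normalizedCoeff, ← Real.exp_add]
    push_cast
    rw [← add_assoc, ← hx]
    ring_nf
  have h9 : x + B = x * (1 + B * (1 / x)) := by field_simp
  rw [h8, h9, ← mul_assoc]
  have := (normalizedCoeff_pos (α := α) (r := r) (n := n) (j + 1)).le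
  gcongr

/-- Raabe's test: with `x = n + j` and `B = α r n^r`, the decay estimate reads `(B - 1) a_{j+1} ≤ x
a_j - (x + 1) a_{j+1}`, whose right side telescopes. -/
theorem sum_range_normalizedCoeff_succ_le (hα : 0 ≤ α) (hr0 : 0 ≤ r) (hn : 0 < n)
    (hB : 1 ≤ α * r * (n : ℝ) ^ r) (N : ℕ) :
    (α * r * (n : ℝ) ^ r - 1) * ∑ j ∈ Finset.range N, normalizedCoeff α r n (j + 1) ≤
      n - (n + N) * normalizedCoeff α r n N := by
  induction N with
  | zero => simp [normalizedCoeff_zero]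
  | succ N ih =>
    have h := add_mul_normalizedCoeff_succ_le hα hr0 hn hB N
    rw [Finset.sum_range_succ, mul_add]
    push_cast
    linarith

theorem sum_range_normalizedCoeff_succ_le_div (hα : 0 ≤ α) (hr0 : 0 ≤ r) (hn : 0 < n)
    (hB : 2 ≤ α * r * (n : ℝ) ^ r) (N : ℕ) :
    ∑ j ∈ Finset.range N, normalizedCoeff α r n (j + 1) ≤ n / (α * r * (n : ℝ) ^ r - 1) := by
  rw [le_div_iff₀' (by linarith)]
  refine (sum_range_normalizedCoeff_succ_le hα hr0 hn (by linarith) N).trans ?_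
  have := (normalizedCoeff_pos (α := α) (r := r) (n := n) N).le
  have : 0 ≤ ((n : ℝ) + N) * normalizedCoeff α r n N := by positivity
  linarith

theorem summable_normalizedCoeff (hα : 0 ≤ α) (hr0 : 0 ≤ r) (hn : 0 < n)
    (hB : 2 ≤ α * r * (n : ℝ) ^ r) : Summable (normalizedCoeff α r n) :=
  (summable_nat_add_iff 1).1 (summable_of_sum_range_le (fun _ => (normalizedCoeff_pos _).le)
    (sum_range_normalizedCoeff_succ_le_div hα hr0 hn hB))

theorem tsum_normalizedCoeff_le (hα : 0 ≤ α) (hr0 : 0 ≤ r) (hn : 0 < n)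
    (hB : 2 ≤ α * r * (n : ℝ) ^ r) (hρ : α * r / (n : ℝ) ^ (1 - r) ≤ 1) :
    ∑' j, normalizedCoeff α r n j ≤ 3 / (α * r / (n : ℝ) ^ (1 - r)) := by
  have hn0 : (0 : ℝ) < n := by exact_mod_cast hn
  have e : α * r / (n : ℝ) ^ (1 - r) = α * r * (n : ℝ) ^ r / n := by
    rw [Real.rpow_sub hn0, Real.rpow_one]
    field_simp
  have h1 := Real.tsum_le_of_sum_range_le (fun _ => (normalizedCoeff_pos _).le)
    (sum_range_normalizedCoeff_succ_le_div hα hr0 hn hB)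
  rw [(summable_normalizedCoeff hα hr0 hn hB).tsum_eq_zero_add, normalizedCoeff_zero]
  rw [e] at hρ ⊢
  set B := α * r * (n : ℝ) ^ r
  have hBn : B ≤ n := by rwa [div_le_one hn0] at hρ
  have hB0 : 0 < B := by linarith
  -- Here `n / B` is `1 / ρ`. The tail takes two of the three units because `B ≥ 2`; the term `a_0 =
  -- 1` takes the third because `ρ ≤ 1`.
  have h2 : (n : ℝ) / (B - 1) ≤ 2 * (n / B) := by
    rw [mul_div_assoc', div_le_div_iff₀ (by linarith) hB0]
    nlinarith
  have h3 : 1 ≤ (n : ℝ) / B := by rwa [one_le_div hB0]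
  have e3 : 3 / (B / n) = 3 * ((n : ℝ) / B) := by field_simp
  rw [e3]
  linarith

/-- The two properties of `n ≥ n₁` that are used. -/
theorem two_le_and_le_one_of_n₁_le (hα : 0 < α) (hr0 : 0 < r) (hr1 : r < 1) (hn : n₁ α r ≤ n) :
    0 < n ∧ 2 ≤ α * r * (n : ℝ) ^ r ∧ α * r / (n : ℝ) ^ (1 - r) ≤ 1 := by
  obtain ⟨h1, h2⟩ := (isLeast_n₁ hα hr0 hr1).1
  set k := n₁ α r
  have hk0 : (0 : ℝ) < k := by exact_mod_cast h1
  have hkn : (k : ℝ) ≤ n := by exact_mod_cast hn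
  have hn0 : (0 : ℝ) < n := hk0.trans_le hkn
  have hA : 0 < α * r := mul_pos hα hr0
  have hρ0 : 0 < α * r / (k : ℝ) ^ (1 - r) := by positivity
  have hkr : 0 < (k : ℝ) ^ r := by positivity
  have hc : 1 / (3 * Real.pi) ^ 3 ≤ (1 : ℝ) / 2 := by
    have : (3 : ℝ) * 2 ≤ 3 * Real.pi := by linarith [Real.two_le_pi]
    have h : ((3 : ℝ) * 2) ^ 3 ≤ (3 * Real.pi) ^ 3 := by gcongr
    exact one_div_le_one_div_of_le (by norm_num) (by linarith)
  -- The logarithm could be negative, so this cannot be read off the second summand alone. If `ρ >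
  -- 1`, then `ln(π/ρ) ≥ 1 - ρ` bounds the first summand below by `(2 - ρ)/(ρ k)`. This is
  -- nonnegative for `ρ ≤ 2` and at least `-1` otherwise, so the whole left side is at least `1`.
  have hρ : α * r / (k : ℝ) ^ (1 - r) ≤ 1 := by
    by_contra! hlt
    have e1 : Real.log (Real.pi * (k : ℝ) ^ (1 - r) / (α * r)) =
        -Real.log (α * r / (k : ℝ) ^ (1 - r) / Real.pi) := by
      rw [← Real.log_inv]
      congr 1
      field_simp
    have e2 : 1 / (α * r) * (1 / (k : ℝ) ^ r) = 1 / (α * r / (k : ℝ) ^ (1 - r) * k) := by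
      rw [Real.rpow_sub hk0, Real.rpow_one]
      field_simp
    rw [e1, e2] at h2
    set ρ := α * r / (k : ℝ) ^ (1 - r)
    have hk1 : (1 : ℝ) ≤ k := by exact_mod_cast h1
    have h3 := Real.log_le_sub_one_of_pos (div_pos hρ0 Real.pi_pos)
    have h4 : ρ / Real.pi ≤ ρ := div_le_self hρ0.le (by linarith [Real.two_le_pi])
    have h5 : 1 / (ρ * k) * (2 - ρ) ≤ 1 / (ρ * k) * (1 + -Real.log (ρ / Real.pi)) := by
      gcongr
      linarith
    have h6 : 1 / (ρ * k) * ρ ≤ 1 := by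
      rw [one_div_mul_eq_div, div_le_one (by positivity)]
      nlinarith
    rcases le_total ρ 2 with h7 | h7
    · have : 0 ≤ 1 / (ρ * k) * (2 - ρ) := mul_nonneg (by positivity) (by linarith)
      linarith
    · have : 0 ≤ 1 / (ρ * k) := by positivity
      nlinarith
  have hL : 0 ≤ Real.log (Real.pi * (k : ℝ) ^ (1 - r) / (α * r)) := by
    refine Real.log_nonneg ?_
    rw [le_div_iff₀ hA]
    rw [div_le_one (by positivity)] at hρ
    have : 0 < (k : ℝ) ^ (1 - r) := by positivity
    nlinarith [Real.two_le_pi]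
  have hB : 2 ≤ α * r * (k : ℝ) ^ r := by
    have h3 : 1 / (α * r) * (1 / (k : ℝ) ^ r) ≤ 1 / (α * r) * (1 / (k : ℝ) ^ r) *
        (1 + Real.log (Real.pi * (k : ℝ) ^ (1 - r) / (α * r))) :=
      le_mul_of_one_le_right (by positivity) (by linarith)
    have h4 : 1 / (α * r * (k : ℝ) ^ r) ≤ 1 / 2 := by
      rw [← one_div_mul_one_div]
      linarith
    exact (one_div_le_one_div (by positivity) (by norm_num)).1 h4
  -- The defining inequality is known only at `n₁`, but both consequences are monotone in `n`.
  refine ⟨by exact_mod_cast hn0, hB.trans (by gcongr), le_trans ?_ hρ⟩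
  have : (k : ℝ) ^ (1 - r) ≤ (n : ℝ) ^ (1 - r) :=
    Real.rpow_le_rpow hk0.le hkn (by linarith)
  gcongr

end

/-! ### Fourier coefficients of absolutely convergent trigonometric series -/

theorem integral_cos_int_mul_sub (z : ℤ) (η : ℝ) :
    ∫ x in (-Real.pi)..Real.pi, Real.cos (z * x - η) =
      if z = 0 then 2 * Real.pi * Real.cos η else 0 := by
  split_ifs with h
  · simp only [h, Int.cast_zero, zero_mul, zero_sub, Real.cos_neg,
      intervalIntegral.integral_const, smul_eq_mul]
    ring
  · have hz : (z : ℝ) ≠ 0 := by exact_mod_cast h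
    rw [intervalIntegral.integral_comp_mul_sub _ hz, integral_cos]
    have : (z : ℝ) * Real.pi - η = z * -Real.pi - η + z * (2 * Real.pi) := by ring
    rw [this, Real.sin_add_int_mul_two_pi]
    simp

theorem integral_cos_mul_cos (j k : ℕ) (ψ η : ℝ) :
    ∫ x in (-Real.pi)..Real.pi, Real.cos (((j : ℝ) + 1) * x - ψ) * Real.cos (k * x - η) =
      if k = j + 1 then Real.pi * Real.cos (ψ - η) else 0 := by
  have e : ∀ x : ℝ, Real.cos (((j : ℝ) + 1) * x - ψ) * Real.cos (k * x - η) =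
      1 / 2 * Real.cos (((j + 1 + k : ℕ) : ℤ) * x - (ψ + η)) +
      1 / 2 * Real.cos (((j + 1 : ℤ) - k : ℤ) * x - (ψ - η)) := by
    intro x
    have h1 : ((((j + 1 + k : ℕ) : ℤ) : ℝ) * x - (ψ + η)) =
        (((j : ℝ) + 1) * x - ψ) + (k * x - η) := by push_cast; ring
    have h2 : ((((j + 1 : ℤ) - k : ℤ) : ℝ) * x - (ψ - η)) =
        (((j : ℝ) + 1) * x - ψ) - (k * x - η) := by push_cast; ring
    rw [h1, h2, Real.cos_add (_ - ψ), Real.cos_sub (_ - ψ)]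
    ring
  simp only [e]
  rw [intervalIntegral.integral_add (Continuous.intervalIntegrable (by fun_prop) _ _)
    (Continuous.intervalIntegrable (by fun_prop) _ _), intervalIntegral.integral_const_mul,
    intervalIntegral.integral_const_mul, integral_cos_int_mul_sub, integral_cos_int_mul_sub,
    if_neg (by omega)]
  by_cases h : k = j + 1
  · rw [if_pos (by omega), if_pos h]
    ring
  · rw [if_neg (by omega), if_neg h]
    ring

/-- Termwise integration of a dominated series against an integrable function. -/
theorem hasSum_mul_integral {μ : Measure ℝ} {b : ℕ → ℝ} (hb : Summable b) {v : ℕ → ℝ → ℝ}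
    (hv : ∀ j, Continuous (v j)) (hv1 : ∀ j t, |v j t| ≤ 1) {ψ : ℝ → ℝ} (hψ : Integrable ψ μ) :
    HasSum (fun j => b j * ∫ t, v j t * ψ t ∂μ) (∫ t, (∑' j, b j * v j t) * ψ t ∂μ) := by
  have hint : ∀ j, Integrable (fun t => v j t * ψ t) μ := fun j =>
    hψ.bdd_mul (hv j).aestronglyMeasurable (Filter.Eventually.of_forall (hv1 j))
  have hF : ∀ j, Integrable (fun t => b j * (v j t * ψ t)) μ := fun j => (hint j).const_mul _
  have hsum : Summable fun j => ∫ t, ‖b j * (v j t * ψ t)‖ ∂μ := by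
    refine Summable.of_nonneg_of_le (fun j => integral_nonneg fun t => norm_nonneg _)
      (fun j => ?_) (hb.norm.mul_right (∫ t, ‖ψ t‖ ∂μ))
    simp only [norm_mul (b j)]
    rw [integral_const_mul]
    refine mul_le_mul_of_nonneg_left (integral_mono (hint j).norm hψ.norm fun t => ?_)
      (norm_nonneg _)
    simp only [norm_mul]
    exact mul_le_of_le_one_left (norm_nonneg _) (hv1 j t)
  have h := hasSum_integral_of_summable_integral_norm hF hsum
  simp only [integral_const_mul] at h
  have e : ∀ t, ∑' j, b j * (v j t * ψ t) = (∑' j, b j * v j t) * ψ t := fun t => by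
    simp only [← tsum_mul_right, mul_assoc]
  simpa only [e] using h

theorem continuous_tsum_mul_cos {A : ℕ → ℝ} (hA : Summable A) (ψ : ℝ) :
    Continuous fun x : ℝ => ∑' j : ℕ, A j * Real.cos (((j : ℝ) + 1) * x - ψ) := by
  refine continuous_tsum (fun j => by fun_prop) hA.norm fun j t => ?_
  rw [norm_mul]
  exact mul_le_of_le_one_right (norm_nonneg _) (Real.abs_cos_le_one _)

/-- The free phases treat sines and cosines together: phase `π/2` turns a cosine into a sine. Index
`j` carries frequency `j + 1`, hence `A (k - 1)`. -/
theorem integral_tsum_mul_cos_mul_cos {A : ℕ → ℝ} (hA : Summable A) (ψ η : ℝ) (k : ℕ) :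
    ∫ x in (-Real.pi)..Real.pi, (∑' j : ℕ, A j * Real.cos (((j : ℝ) + 1) * x - ψ)) *
      Real.cos (k * x - η) = if k = 0 then 0 else Real.pi * (A (k - 1) * Real.cos (ψ - η)) := by
  have hle : -Real.pi ≤ Real.pi := by linarith [Real.pi_pos]
  have hψ : IntervalIntegrable (fun x : ℝ => Real.cos (k * x - η)) volume (-Real.pi) Real.pi :=
    Continuous.intervalIntegrable (by fun_prop) _ _
  have h := (hasSum_mul_integral hA (v := fun j x => Real.cos (((j : ℝ) + 1) * x - ψ))
    (fun j => by fun_prop) (fun j t => Real.abs_cos_le_one _)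
    ((intervalIntegrable_iff_integrableOn_Ioc_of_le hle).1 hψ)).tsum_eq
  simp only [← intervalIntegral.integral_of_le hle, integral_cos_mul_cos] at h
  rw [← h]
  split_ifs with hk
  · simp [hk]
  · rw [tsum_eq_single (k - 1)]
    · rw [if_pos (by omega)]
      ring
    · intro j hj
      rw [if_neg (by omega), mul_zero]

/-- The trigonometric series `c / 2 + ∑ (A_j cos ((j + 1) x) + B_j sin ((j + 1) x))`. -/
noncomputable def trigSeries (c : ℝ) (A B : ℕ → ℝ) (x : ℝ) : ℝ :=
  c / 2 + ∑' j : ℕ, (A j * Real.cos (((j : ℝ) + 1) * x) + B j * Real.sin (((j : ℝ) + 1) * x))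

section

variable {c : ℝ} {A B : ℕ → ℝ}

theorem summable_mul_cos_sub (hA : Summable A) (ψ x : ℝ) :
    Summable fun j : ℕ => A j * Real.cos (((j : ℝ) + 1) * x - ψ) := by
  refine Summable.of_norm_bounded hA.norm fun j => ?_
  rw [norm_mul]
  exact mul_le_of_le_one_right (norm_nonneg _) (Real.abs_cos_le_one _)

theorem summable_trigSeries (hA : Summable A) (hB : Summable B) (x : ℝ) :
    Summable fun j : ℕ =>
      A j * Real.cos (((j : ℝ) + 1) * x) + B j * Real.sin (((j : ℝ) + 1) * x) := by
  simpa only [sub_zero, Real.cos_sub_pi_div_two] using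
    (summable_mul_cos_sub hA 0 x).add (summable_mul_cos_sub hB (Real.pi / 2) x)

theorem trigSeries_eq (hA : Summable A) (hB : Summable B) (x : ℝ) :
    trigSeries c A B x = c / 2 + ((∑' j : ℕ, A j * Real.cos (((j : ℝ) + 1) * x - 0)) +
      ∑' j : ℕ, B j * Real.cos (((j : ℝ) + 1) * x - Real.pi / 2)) := by
  rw [← (summable_mul_cos_sub hA 0 x).tsum_add (summable_mul_cos_sub hB (Real.pi / 2) x)]
  simp only [sub_zero, Real.cos_sub_pi_div_two, trigSeries]

theorem integral_trigSeries_mul_cos (hA : Summable A) (hB : Summable B) (η : ℝ) (k : ℕ) :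
    ∫ x in (-Real.pi)..Real.pi, trigSeries c A B x * Real.cos (k * x - η) =
      if k = 0 then Real.pi * (c * Real.cos η) else
        Real.pi * (A (k - 1) * Real.cos η + B (k - 1) * Real.sin η) := by
  have hcA := continuous_tsum_mul_cos hA 0
  have hcB := continuous_tsum_mul_cos hB (Real.pi / 2)
  have hcos : Continuous fun x : ℝ => Real.cos (k * x - η) := by fun_prop
  have e : ∀ x, trigSeries c A B x * Real.cos (k * x - η) = c / 2 * Real.cos (k * x - η) +
      ((∑' j : ℕ, A j * Real.cos (((j : ℝ) + 1) * x - 0)) * Real.cos (k * x - η) +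
      (∑' j : ℕ, B j * Real.cos (((j : ℝ) + 1) * x - Real.pi / 2)) * Real.cos (k * x - η)) := by
    intro x
    rw [trigSeries_eq hA hB]
    ring
  have hAc : Continuous fun x : ℝ =>
      (∑' j : ℕ, A j * Real.cos (((j : ℝ) + 1) * x - 0)) * Real.cos (k * x - η) := hcA.mul hcos
  have hBc : Continuous fun x : ℝ =>
      (∑' j : ℕ, B j * Real.cos (((j : ℝ) + 1) * x - Real.pi / 2)) * Real.cos (k * x - η) :=
    hcB.mul hcos
  simp only [e]
  rw [intervalIntegral.integral_add ((hcos.const_mul _).intervalIntegrable _ _)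
    ((hAc.fun_add hBc).intervalIntegrable _ _),
    intervalIntegral.integral_add (hAc.intervalIntegrable _ _) (hBc.intervalIntegrable _ _),
    integral_tsum_mul_cos_mul_cos hA, integral_tsum_mul_cos_mul_cos hB,
    intervalIntegral.integral_const_mul]
  have h := integral_cos_int_mul_sub k η
  simp only [Int.cast_natCast, Nat.cast_eq_zero] at h
  rw [h]
  split_ifs with hk
  · ring
  · rw [zero_sub, Real.cos_neg, Real.cos_pi_div_two_sub]
    ring

theorem fourierCos_trigSeries (hA : Summable A) (hB : Summable B) (k : ℕ) :
    fourierCos (trigSeries c A B) k = if k = 0 then c else A (k - 1) := by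
  have h := integral_trigSeries_mul_cos (c := c) hA hB 0 k
  have := Real.pi_pos.ne'
  simp only [sub_zero, Real.cos_zero, Real.sin_zero, mul_zero, add_zero, mul_one] at h
  rw [fourierCos, h]
  split_ifs <;> field_simp

theorem fourierSin_trigSeries (hA : Summable A) (hB : Summable B) {k : ℕ} (hk : k ≠ 0) :
    fourierSin (trigSeries c A B) k = B (k - 1) := by
  have h := integral_trigSeries_mul_cos (c := c) hA hB (Real.pi / 2) k
  have := Real.pi_pos.ne'
  simp only [Real.cos_sub_pi_div_two, Real.cos_pi_div_two, Real.sin_pi_div_two, mul_zero,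
    zero_add, mul_one, if_neg hk] at h
  rw [fourierSin, h]
  field_simp

/-- Absolute convergence makes the coefficients of the series its Fourier coefficients, so `S_N` is
the truncation and the tail remains. -/
theorem trigSeries_sub_partialFourierSum (hA : Summable A) (hB : Summable B) (N : ℕ) (x : ℝ) :
    trigSeries c A B x - partialFourierSum N (trigSeries c A B) x =
      ∑' j : ℕ, (A (j + N) * Real.cos (((j + N : ℕ) + 1 : ℝ) * x) +
        B (j + N) * Real.sin (((j + N : ℕ) + 1 : ℝ) * x)) := by
  rw [partialFourierSum, fourierCos_trigSeries hA hB, if_pos rfl]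
  have h : ∑ k ∈ Finset.Icc 1 N, (fourierCos (trigSeries c A B) k * Real.cos (k * x) +
      fourierSin (trigSeries c A B) k * Real.sin (k * x)) =
      ∑ j ∈ Finset.range N,
        (A j * Real.cos (((j : ℝ) + 1) * x) + B j * Real.sin (((j : ℝ) + 1) * x)) := by
    rw [← Finset.Ico_add_one_right_eq_Icc, Finset.sum_Ico_eq_sum_range]
    refine Finset.sum_congr rfl fun j _ => ?_
    rw [fourierCos_trigSeries hA hB, fourierSin_trigSeries hA hB (by omega), if_neg (by omega),
      add_tsub_cancel_left]
    push_cast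
    ring_nf
  rw [h, trigSeries, ← (summable_trigSeries hA hB x).sum_add_tsum_nat_add N]
  ring

end

/-! ### Integration over a period -/

instance : IsFiniteMeasure periodMeasure := by
  unfold periodMeasure
  infer_instance

theorem integral_periodMeasure (g : ℝ → ℝ) :
    ∫ t, g t ∂periodMeasure = ∫ t in (0 : ℝ)..2 * Real.pi, g t := by
  rw [intervalIntegral.integral_of_le (by positivity), periodMeasure, integral_Ico_eq_integral_Ioc]

theorem integral_periodMeasure_of_periodic {g : ℝ → ℝ} (hg : Function.Periodic g (2 * Real.pi))
    (s : ℝ) : ∫ t, g t ∂periodMeasure = ∫ t in s..s + 2 * Real.pi, g t := by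
  rw [integral_periodMeasure, hg.intervalIntegral_add_eq s 0, zero_add]

theorem integral_neg_pi_pi_eq {g : ℝ → ℝ} (hg : Function.Periodic g (2 * Real.pi)) :
    ∫ t in (-Real.pi)..Real.pi, g t = ∫ t, g t ∂periodMeasure := by
  rw [integral_periodMeasure_of_periodic hg (-Real.pi)]
  congr 1
  ring

theorem integrable_periodMeasure_of_continuous {g : ℝ → ℝ} (hg : Continuous g) :
    Integrable g periodMeasure := by
  have h := hg.integrableOn_Icc (μ := volume) (a := 0) (b := 2 * Real.pi)
  exact h.mono_set Set.Ico_subset_Icc_self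

/-! ### Remainders of Fourier series of convolutions with a cosine series -/

section

variable {q : ℕ → ℝ} {θ : ℝ} {φ : ℝ → ℝ}

theorem integral_shiftedCosSeries_mul (hq : Summable q) (hφ : Integrable φ periodMeasure)
    (m x : ℝ) :
    ∫ t, shiftedCosSeries q m θ (x - t) * φ t ∂periodMeasure =
      ∑' j : ℕ, (q j * (∫ t, Real.cos ((m + j) * t + θ) * φ t ∂periodMeasure) *
          Real.cos ((m + j) * x) +
        q j * (∫ t, Real.sin ((m + j) * t + θ) * φ t ∂periodMeasure) *
          Real.sin ((m + j) * x)) := by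
  have h := (hasSum_mul_integral hq (v := fun j t => Real.cos ((m + j) * (x - t) - θ))
    (fun j => by fun_prop) (fun j t => Real.abs_cos_le_one _) hφ).tsum_eq
  simp only [shiftedCosSeries]
  rw [← h]
  refine tsum_congr fun j => ?_
  have hc : Integrable (fun t => Real.cos ((m + j) * t + θ) * φ t) periodMeasure :=
    hφ.bdd_mul (Continuous.aestronglyMeasurable (by fun_prop))
      (Filter.Eventually.of_forall fun t => Real.abs_cos_le_one _)
  have hs : Integrable (fun t => Real.sin ((m + j) * t + θ) * φ t) periodMeasure :=
    hφ.bdd_mul (Continuous.aestronglyMeasurable (by fun_prop))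
      (Filter.Eventually.of_forall fun t => Real.abs_sin_le_one _)
  have e : ∀ t, Real.cos ((m + j) * (x - t) - θ) * φ t =
      Real.cos ((m + j) * x) * (Real.cos ((m + j) * t + θ) * φ t) +
      Real.sin ((m + j) * x) * (Real.sin ((m + j) * t + θ) * φ t) := by
    intro t
    have : (m + j) * (x - t) - θ = (m + j) * x - ((m + j) * t + θ) := by ring
    rw [this, Real.cos_sub]
    ring
  simp only [e]
  rw [integral_add (hc.const_mul _) (hs.const_mul _), integral_const_mul, integral_const_mul]
  ring

theorem summable_mul_integral (hq : Summable q) {v : ℕ → ℝ → ℝ} (hv : ∀ j, Continuous (v j))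
    (hv1 : ∀ j t, |v j t| ≤ 1) (hφ : Integrable φ periodMeasure) :
    Summable fun j => q j * ∫ t, v j t * φ t ∂periodMeasure :=
  (hasSum_mul_integral hq hv hv1 hφ).summable

/-- The addition formula expands the convolution into a trigonometric series. Removing frequencies
up to `N` and reading the same expansion backwards gives the convolution with the tail of the
kernel. -/
theorem sub_partialFourierSum_eq (hq : Summable q) (hφ : Integrable φ periodMeasure)
    (hper : Function.Periodic φ (2 * Real.pi)) {f : ℝ → ℝ} {a₀ : ℝ}
    (hf : ∀ x, f x = a₀ / 2 + 1 / Real.pi *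
      ∫ t in (-Real.pi)..Real.pi, shiftedCosSeries q 1 θ (x - t) * φ t) (N : ℕ) (x : ℝ) :
    f x - partialFourierSum N f x = 1 / Real.pi *
      ∫ t, shiftedCosSeries (fun j => q (j + N)) ((N + 1 : ℕ) : ℝ) θ (x - t) * φ t
        ∂periodMeasure := by
  set A : ℕ → ℝ := fun j => 1 / Real.pi *
    (q j * ∫ t, Real.cos ((1 + j) * t + θ) * φ t ∂periodMeasure) with hA
  set B : ℕ → ℝ := fun j => 1 / Real.pi *
    (q j * ∫ t, Real.sin ((1 + j) * t + θ) * φ t ∂periodMeasure) with hB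
  have hAs : Summable A := (summable_mul_integral hq
    (v := fun j t => Real.cos ((1 + j) * t + θ)) (fun j => by fun_prop)
    (fun j t => Real.abs_cos_le_one _) hφ).mul_left _
  have hBs : Summable B := (summable_mul_integral hq
    (v := fun j t => Real.sin ((1 + j) * t + θ)) (fun j => by fun_prop)
    (fun j t => Real.abs_sin_le_one _) hφ).mul_left _
  have hQ : Function.Periodic (shiftedCosSeries q 1 θ) (2 * Real.pi) := by
    simpa using periodic_shiftedCosSeries (a := q) (θ := θ) 1
  have hfT : f = trigSeries a₀ A B := by
    funext x
    have hg : Function.Periodic (fun t => shiftedCosSeries q 1 θ (x - t) * φ t)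
        (2 * Real.pi) := by
      intro t
      simp only
      rw [hper t, ← sub_sub, hQ.sub_eq]
    rw [hf, integral_neg_pi_pi_eq hg, integral_shiftedCosSeries_mul hq hφ, trigSeries,
      ← tsum_mul_left]
    congr 1
    refine tsum_congr fun j => ?_
    have e : (j : ℝ) + 1 = 1 + j := add_comm _ _
    simp only [hA, hB, e]
    ring
  rw [hfT, trigSeries_sub_partialFourierSum hAs hBs,
    integral_shiftedCosSeries_mul ((summable_nat_add_iff N).2 hq) hφ, ← tsum_mul_left]
  refine tsum_congr fun j => ?_
  have e : (1 : ℝ) + (j + N : ℕ) = ((N + 1 : ℕ) : ℝ) + j := by push_cast; ring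
  have e2 : ((j + N : ℕ) : ℝ) + 1 = ((N + 1 : ℕ) : ℝ) + j := by push_cast; ring
  simp only [hA, hB, e, e2]
  ring

/-- Young's inequality for convolutions over a period. -/
theorem periodNorm_convolution_le {G : ℝ → ℝ} (hG : Continuous G)
    (hGper : Function.Periodic G (2 * Real.pi)) (hφ : Integrable φ periodMeasure)
    (hφ1 : periodNorm 1 φ ≤ 1) :
    periodNorm 1 (fun x => ∫ t, G (x - t) * φ t ∂periodMeasure) ≤
      ENNReal.ofReal (∫ t in (-Real.pi)..Real.pi, |G t|) := by
  rw [periodNorm, eLpNorm_one_eq_lintegral_enorm] at *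
  have hinner : ∀ t, ∫⁻ x, ‖G (x - t)‖ₑ ∂periodMeasure =
      ENNReal.ofReal (∫ t in (-Real.pi)..Real.pi, |G t|) := by
    intro t
    have habs : Function.Periodic (fun t => |G t|) (2 * Real.pi) := fun x => by
      simp only [hGper x]
    rw [← ofReal_integral_norm_eq_lintegral_enorm
      (integrable_periodMeasure_of_continuous (by fun_prop))]
    simp only [Real.norm_eq_abs]
    rw [integral_periodMeasure, intervalIntegral.integral_comp_sub_right (fun x => |G x|),
      integral_neg_pi_pi_eq habs, integral_periodMeasure_of_periodic habs (0 - t)]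
    congr 2
    ring
  calc ∫⁻ x, ‖∫ t, G (x - t) * φ t ∂periodMeasure‖ₑ ∂periodMeasure
      ≤ ∫⁻ x, ∫⁻ t, ‖G (x - t)‖ₑ * ‖φ t‖ₑ ∂periodMeasure ∂periodMeasure := by
        refine lintegral_mono fun x => (enorm_integral_le_lintegral_enorm _).trans_eq ?_
        simp only [enorm_mul]
    _ = ∫⁻ t, ∫⁻ x, ‖G (x - t)‖ₑ * ‖φ t‖ₑ ∂periodMeasure ∂periodMeasure := by
        have h1 : AEMeasurable (fun z : ℝ × ℝ => ‖G (z.1 - z.2)‖ₑ)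
            (periodMeasure.prod periodMeasure) := Continuous.aemeasurable (by fun_prop)
        exact lintegral_lintegral_swap (h1.mul hφ.aestronglyMeasurable.comp_snd.enorm)
    _ = ∫⁻ t, ENNReal.ofReal (∫ t in (-Real.pi)..Real.pi, |G t|) * ‖φ t‖ₑ ∂periodMeasure := by
        refine lintegral_congr fun t => ?_
        rw [lintegral_mul_const _ (Continuous.measurable (by fun_prop)), hinner]
    _ = ENNReal.ofReal (∫ t in (-Real.pi)..Real.pi, |G t|) * ∫⁻ t, ‖φ t‖ₑ ∂periodMeasure :=
        lintegral_const_mul' _ _ ENNReal.ofReal_ne_top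
    _ ≤ _ := mul_le_of_le_one_right' hφ1

end

/-! ### Concentration of mean-zero functions at two opposite points -/

/-- A non-negative bump concentrated near the multiples of `2π`. -/
noncomputable def cosBump (δ t : ℝ) : ℝ := max (Real.cos t - Real.cos δ) 0

theorem continuous_cosBump (δ : ℝ) : Continuous (cosBump δ) := by
  unfold cosBump
  fun_prop

theorem cosBump_nonneg (δ t : ℝ) : 0 ≤ cosBump δ t := le_max_right _ _

theorem periodic_cosBump (δ : ℝ) : Function.Periodic (cosBump δ) (2 * Real.pi) := fun t => by
  simp only [cosBump, Real.cos_add_two_pi]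

theorem cosBump_eq_zero {δ t : ℝ} (hδ : 0 ≤ δ) (h : δ ≤ |t|) (ht : |t| ≤ Real.pi) :
    cosBump δ t = 0 := by
  refine max_eq_right (sub_nonpos.2 ?_)
  rw [← Real.cos_abs t]
  exact Real.cos_le_cos_of_nonneg_of_le_pi hδ ht h

theorem integral_cosBump_pos {δ : ℝ} (hδ : 0 < δ) (hδ1 : δ < Real.pi) :
    0 < ∫ t, cosBump δ t ∂periodMeasure := by
  rw [integral_periodMeasure]
  refine intervalIntegral.integral_pos (by positivity) (continuous_cosBump δ).continuousOn
    (fun t _ => cosBump_nonneg δ t) ⟨0, ⟨le_rfl, by positivity⟩, ?_⟩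
  have h := Real.cos_lt_cos_of_nonneg_of_le_pi le_rfl hδ1.le hδ
  exact lt_max_of_lt_left (sub_pos.2 h)

theorem integral_periodMeasure_comp_add {g : ℝ → ℝ} (hg : Function.Periodic g (2 * Real.pi))
    (s : ℝ) : ∫ t, g (t + s) ∂periodMeasure = ∫ t, g t ∂periodMeasure := by
  rw [integral_periodMeasure, intervalIntegral.integral_comp_add_right g,
    integral_periodMeasure_of_periodic hg (0 + s)]
  congr 1
  ring

/-- Two opposite bumps of opposite sign. -/
noncomputable def doubleBump (δ t : ℝ) : ℝ :=
  (2 * ∫ t, cosBump δ t ∂periodMeasure)⁻¹ * (cosBump δ t - cosBump δ (t + Real.pi))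

theorem continuous_doubleBump (δ : ℝ) : Continuous (doubleBump δ) := by
  have := continuous_cosBump δ
  unfold doubleBump
  fun_prop

theorem periodic_doubleBump (δ : ℝ) : Function.Periodic (doubleBump δ) (2 * Real.pi) := fun t => by
  simp only [doubleBump]
  rw [periodic_cosBump δ t, add_right_comm, periodic_cosBump δ]

theorem integrable_cosBump_add (δ s : ℝ) :
    Integrable (fun t => cosBump δ (t + s)) periodMeasure :=
  integrable_periodMeasure_of_continuous ((continuous_cosBump δ).comp (continuous_add_const s))

/-- The bumps are translates of each other, so they have equal mass: their difference has mean zero,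
and the factor `(2 * mass)⁻¹` normalises it. -/
theorem doubleBump_mem_zeroMeanBall {δ : ℝ} (hδ : 0 < δ) (hδ1 : δ < Real.pi) :
    doubleBump δ ∈ zeroMeanBall 1 := by
  have hJ := integral_cosBump_pos hδ hδ1
  have h0 : Integrable (cosBump δ) periodMeasure :=
    integrable_periodMeasure_of_continuous (continuous_cosBump δ)
  have h1 := integrable_cosBump_add δ Real.pi
  have hshift := integral_periodMeasure_comp_add (periodic_cosBump δ) Real.pi
  have hint := integrable_periodMeasure_of_continuous (continuous_doubleBump δ)
  refine ⟨periodic_doubleBump δ, hint.aestronglyMeasurable, ?_, ?_⟩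
  · rw [periodNorm, eLpNorm_one_eq_lintegral_enorm, ← ofReal_integral_norm_eq_lintegral_enorm hint,
      ← ENNReal.ofReal_one]
    refine ENNReal.ofReal_le_ofReal ?_
    have hle : ∫ t, ‖doubleBump δ t‖ ∂periodMeasure ≤
        ∫ t, (2 * ∫ t, cosBump δ t ∂periodMeasure)⁻¹ *
          (cosBump δ t + cosBump δ (t + Real.pi)) ∂periodMeasure := by
      refine integral_mono hint.norm ((h0.add h1).const_mul _) fun t => ?_
      simp only [doubleBump]
      rw [norm_mul, Real.norm_of_nonneg (by positivity)]
      refine mul_le_mul_of_nonneg_left ((norm_sub_le _ _).trans_eq ?_) (by positivity)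
      rw [Real.norm_of_nonneg (cosBump_nonneg _ _), Real.norm_of_nonneg (cosBump_nonneg _ _)]
    refine hle.trans_eq ?_
    rw [integral_const_mul, integral_add h0 h1, hshift, ← two_mul, inv_mul_cancel₀ (by positivity)]
  · rw [integral_neg_pi_pi_eq (periodic_doubleBump δ)]
    simp only [doubleBump]
    rw [integral_const_mul, integral_sub h0 h1, hshift, sub_self, mul_zero]

theorem integral_mul_doubleBump {G : ℝ → ℝ} (hG : Continuous G)
    (hGper : Function.Periodic G (2 * Real.pi)) (δ x : ℝ) :
    ∫ t, G (x - t) * doubleBump δ t ∂periodMeasure =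
      (2 * ∫ t, cosBump δ t ∂periodMeasure)⁻¹ *
        ∫ t, (G (x - t) - G (x - t - Real.pi)) * cosBump δ t ∂periodMeasure := by
  have hc := continuous_cosBump δ
  have hper : Function.Periodic (fun t => G (x - t - Real.pi) * cosBump δ t) (2 * Real.pi) := by
    intro t
    simp only
    rw [periodic_cosBump δ t]
    have : x - (t + 2 * Real.pi) - Real.pi = x - t - Real.pi - 2 * Real.pi := by ring
    rw [this, hGper.sub_eq]
  have hshift := integral_periodMeasure_comp_add hper Real.pi
  have e : ∀ t, G (x - (t + Real.pi) - Real.pi) * cosBump δ (t + Real.pi) =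
      G (x - t) * cosBump δ (t + Real.pi) := by
    intro t
    have : x - (t + Real.pi) - Real.pi = x - t - 2 * Real.pi := by ring
    rw [this, hGper.sub_eq]
  simp only [e] at hshift
  have e2 : ∀ t, G (x - t) * doubleBump δ t = (2 * ∫ t, cosBump δ t ∂periodMeasure)⁻¹ *
      (G (x - t) * cosBump δ t - G (x - t) * cosBump δ (t + Real.pi)) := by
    intro t
    rw [doubleBump]
    ring
  simp only [e2, sub_mul]
  rw [integral_const_mul, integral_sub (integrable_periodMeasure_of_continuous (by fun_prop))
    (integrable_periodMeasure_of_continuous (by fun_prop)),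
    integral_sub (integrable_periodMeasure_of_continuous (by fun_prop))
    (integrable_periodMeasure_of_continuous (by fun_prop)), hshift]

theorem uniformContinuous_of_periodic {T : ℝ} (hT : 0 < T) {H : ℝ → ℝ} (hH : Continuous H)
    (hper : Function.Periodic H T) : UniformContinuous H := by
  have : Fact (0 < T) := ⟨hT⟩
  have h1 : Continuous (hper.lift : AddCircle T → ℝ) := continuous_coinduced_dom.2 hH
  have h2 : UniformContinuous (fun x : ℝ => (x : AddCircle T)) :=
    uniformContinuous_addMonoidHom_of_continuous (f := QuotientAddGroup.mk' _)
      (AddCircle.continuous_mk' T)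
  exact (CompactSpace.uniformContinuous_of_continuous h1).comp h2

/-- As `δ → 0`, `doubleBump δ` acts like `(δ_0 - δ_π)/2`; uniform continuity of a periodic
continuous function makes the approximation uniform in `x`. -/
theorem exists_abs_integral_mul_doubleBump_sub_le {G : ℝ → ℝ} (hG : Continuous G)
    (hGper : Function.Periodic G (2 * Real.pi)) {ε : ℝ} (hε : 0 < ε) :
    ∃ δ, 0 < δ ∧ δ < Real.pi ∧ ∀ x, |(∫ t, G (x - t) * doubleBump δ t ∂periodMeasure) -
      1 / 2 * (G x - G (x - Real.pi))| ≤ ε := by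
  set H : ℝ → ℝ := fun x => G x - G (x - Real.pi) with hH
  have hHc : Continuous H := by fun_prop
  have hHper : Function.Periodic H (2 * Real.pi) := by
    intro x
    simp only [hH]
    have : x + 2 * Real.pi - Real.pi = x - Real.pi + 2 * Real.pi := by ring
    rw [this, hGper, hGper]
  have hunif : UniformContinuous H := uniformContinuous_of_periodic Real.two_pi_pos hHc hHper
  obtain ⟨δ, hδ, hδH⟩ := Metric.uniformContinuous_iff.1 hunif ε hε
  have hpi := Real.pi_pos
  refine ⟨min δ 1, lt_min hδ one_pos, (min_le_right _ _).trans_lt (by linarith [Real.two_le_pi]),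
    fun x => ?_⟩
  have hδ' : 0 < min δ 1 := lt_min hδ one_pos
  have hJ := integral_cosBump_pos hδ' ((min_le_right _ _).trans_lt (by linarith [Real.two_le_pi]))
  have hc := continuous_cosBump (min δ 1)
  rw [integral_mul_doubleBump hG hGper]
  set J := ∫ t, cosBump (min δ 1) t ∂periodMeasure with hJdef
  have e : (2 * J)⁻¹ * (∫ t, (G (x - t) - G (x - t - Real.pi)) * cosBump (min δ 1) t
      ∂periodMeasure) - 1 / 2 * H x =
      (2 * J)⁻¹ * ∫ t, (H (x - t) - H x) * cosBump (min δ 1) t ∂periodMeasure := by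
    simp only [sub_mul (H _)]
    rw [integral_sub (integrable_periodMeasure_of_continuous (by fun_prop))
      (integrable_periodMeasure_of_continuous (by fun_prop)), integral_const_mul, ← hJdef]
    field_simp
    rfl
  have hper : Function.Periodic (fun t => (H (x - t) - H x) * cosBump (min δ 1) t)
      (2 * Real.pi) := by
    intro t
    simp only
    rw [periodic_cosBump _ t, ← sub_sub, hHper.sub_eq]
  have hb : |∫ t, (H (x - t) - H x) * cosBump (min δ 1) t ∂periodMeasure| ≤ ε * J := by
    rw [← integral_neg_pi_pi_eq hper, hJdef, ← integral_neg_pi_pi_eq (periodic_cosBump _),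
      ← intervalIntegral.integral_const_mul, ← Real.norm_eq_abs]
    refine intervalIntegral.norm_integral_le_of_norm_le (μ := volume) (by linarith)
      (Filter.Eventually.of_forall fun t ht => ?_) ((hc.const_mul ε).intervalIntegrable _ _)
    rw [norm_mul, Real.norm_of_nonneg (cosBump_nonneg _ t)]
    rcases le_or_gt (min δ 1) |t| with h | h
    · rw [cosBump_eq_zero hδ'.le h (abs_le.2 ⟨ht.1.le, ht.2⟩), mul_zero, mul_zero]
    · refine mul_le_mul_of_nonneg_right ?_ (cosBump_nonneg _ t)
      have hd : dist (x - t) x < δ := by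
        rw [Real.dist_eq, sub_sub_cancel_left, abs_neg]
        exact h.trans_le (min_le_left _ _)
      exact (hδH hd).le
  rw [e, abs_mul, abs_of_pos (by positivity)]
  calc (2 * J)⁻¹ * _ ≤ (2 * J)⁻¹ * (ε * J) := by gcongr
    _ = ε / 2 := by field_simp
    _ ≤ ε := by linarith

theorem lintegral_enorm_le_of_approx {w H : ℝ → ℝ} {η : ℝ} (hη : ∀ x, |w x - H x| ≤ η) :
    ∫⁻ x, ‖H x‖ₑ ∂periodMeasure ≤
      periodNorm 1 w + ENNReal.ofReal η * periodMeasure Set.univ := by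
  rw [periodNorm, eLpNorm_one_eq_lintegral_enorm, ← lintegral_const,
    ← lintegral_add_right _ measurable_const]
  refine lintegral_mono fun x => ?_
  have h : ‖H x‖ₑ ≤ ‖w x‖ₑ + ‖H x - w x‖ₑ := by
    simpa using enorm_add_le (w x) (H x - w x)
  refine h.trans (add_le_add le_rfl ?_)
  rw [Real.enorm_eq_ofReal_abs, abs_sub_comm]
  exact ENNReal.ofReal_le_ofReal (hη x)

/-! ### Two-sided bounds for the error of Fourier sums -/

section

variable {α r β : ℝ} {n : ℕ}

/-- The kernel's index `k` carries frequency `k + 1`, so frequency `n + j` sits at index `j + (n -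
1)`. -/
theorem exp_eq_mul_normalizedCoeff (hn : 0 < n) (j : ℕ) :
    Real.exp (-α * (((j + (n - 1) : ℕ) : ℝ) + 1) ^ r) =
      Real.exp (-α * (n : ℝ) ^ r) * normalizedCoeff α r n j := by
  obtain ⟨N, rfl⟩ := Nat.exists_eq_succ_of_ne_zero hn.ne'
  rw [normalizedCoeff, ← Real.exp_add]
  simp only [Nat.succ_eq_add_one, Nat.add_sub_cancel]
  have : ((j + N : ℕ) : ℝ) + 1 = ((N + 1 : ℕ) : ℝ) + j := by push_cast; ring
  rw [this]
  ring_nf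

theorem kernel_eq_shiftedCosSeries (t : ℝ) :
    kernel α r β t = shiftedCosSeries (fun k => Real.exp (-α * ((k : ℝ) + 1) ^ r)) 1
      (β * Real.pi / 2) t := by
  simp only [kernel, shiftedCosSeries, add_comm (1 : ℝ)]

theorem summable_exp_neg_mul_rpow (hn : 0 < n) (ha : Summable (normalizedCoeff α r n)) :
    Summable fun k : ℕ => Real.exp (-α * ((k : ℝ) + 1) ^ r) := by
  refine (summable_nat_add_iff (n - 1)).1 ((ha.mul_left (Real.exp (-α * (n : ℝ) ^ r))).congr ?_)
  exact fun j => (exp_eq_mul_normalizedCoeff hn j).symm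

theorem integrable_of_mem_zeroMeanBall {φ : ℝ → ℝ} (hφ : φ ∈ zeroMeanBall 1) :
    Integrable φ periodMeasure :=
  memLp_one_iff_integrable.1 ⟨hφ.2.1, hφ.2.2.1.trans_lt ENNReal.one_lt_top⟩

/-- The remainder of the Fourier series as a convolution. -/
theorem sub_partialFourierSum_eq_convolution (hn : 0 < n)
    (ha : Summable (normalizedCoeff α r n)) {φ : ℝ → ℝ} (hφ : φ ∈ zeroMeanBall 1) {f : ℝ → ℝ}
    {a₀ : ℝ} (hf : ∀ x, f x = a₀ / 2 + 1 / Real.pi *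
      ∫ t in (-Real.pi)..Real.pi, kernel α r β (x - t) * φ t) (x : ℝ) :
    f x - partialFourierSum (n - 1) f x = Real.exp (-α * (n : ℝ) ^ r) / Real.pi *
      ∫ t, shiftedCosSeries (normalizedCoeff α r n) n (β * Real.pi / 2) (x - t) * φ t
        ∂periodMeasure := by
  simp only [kernel_eq_shiftedCosSeries] at hf
  rw [sub_partialFourierSum_eq (summable_exp_neg_mul_rpow hn ha)
    (integrable_of_mem_zeroMeanBall hφ) hφ.1 hf, Nat.sub_add_cancel hn]
  simp only [exp_eq_mul_normalizedCoeff hn]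
  have e : ∀ t, shiftedCosSeries (fun j => Real.exp (-α * (n : ℝ) ^ r) * normalizedCoeff α r n j)
      n (β * Real.pi / 2) t = Real.exp (-α * (n : ℝ) ^ r) *
        shiftedCosSeries (normalizedCoeff α r n) n (β * Real.pi / 2) t := by
    intro t
    simp only [shiftedCosSeries, mul_assoc, tsum_mul_left]
  simp only [e, mul_assoc]
  rw [integral_const_mul]
  ring

theorem fourierError_le (hn : 0 < n) (ha : Summable (normalizedCoeff α r n))
    (hm : Antitone (normalizedCoeff α r n)) :
    fourierError n α r β 1 1 ≤ ENNReal.ofReal (Real.exp (-α * (n : ℝ) ^ r) / Real.pi *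
      ∫ t in (-Real.pi)..Real.pi,
        |shiftedCosSeries (normalizedCoeff α r n) n (β * Real.pi / 2) t|) := by
  have hpi := Real.pi_pos
  refine iSup₂_le fun f hf => ?_
  obtain ⟨-, a₀, φ, hφ, hf⟩ := hf
  have h := periodNorm_convolution_le
    (continuous_shiftedCosSeries (m := n) (θ := β * Real.pi / 2) ha hm)
    (periodic_shiftedCosSeries n) (integrable_of_mem_zeroMeanBall hφ) hφ.2.2.1
  simp only [sub_partialFourierSum_eq_convolution hn ha hφ hf]
  rw [periodNorm] at h ⊢
  have e := eLpNorm_const_smul (Real.exp (-α * (n : ℝ) ^ r) / Real.pi)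
    (fun x => ∫ t, shiftedCosSeries (normalizedCoeff α r n) n (β * Real.pi / 2) (x - t) * φ t
        ∂periodMeasure) 1 periodMeasure
  rw [ENNReal.ofReal_mul (by positivity)]
  refine e.trans_le ?_
  rw [Real.enorm_of_nonneg (by positivity)]
  exact mul_le_mul_right h _

theorem periodic_convolution {G φ : ℝ → ℝ} {T c : ℝ} (hG : Function.Periodic G T) :
    Function.Periodic (fun x => c + 1 / Real.pi *
      ∫ t in (-Real.pi)..Real.pi, G (x - t) * φ t) T := by
  intro x
  simp only [add_sub_right_comm x T, hG _]

/-- The class is tested on the convolutions of the kernel with `doubleBump δ`, whose remainders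
approach `c/(2π) (K - K(· - π))` uniformly. -/
theorem le_fourierError (hn : 0 < n) (ha : Summable (normalizedCoeff α r n))
    (hm : Antitone (normalizedCoeff α r n)) :
    ENNReal.ofReal (Real.exp (-α * (n : ℝ) ^ r) / (2 * Real.pi) * ∫ x,
      |(shiftedCosSeries (normalizedCoeff α r n) n (β * Real.pi / 2) x -
        shiftedCosSeries (normalizedCoeff α r n) n (β * Real.pi / 2) (x - Real.pi))|
        ∂periodMeasure) ≤ fourierError n α r β 1 1 := by
  have hpi := Real.pi_pos
  set K := shiftedCosSeries (normalizedCoeff α r n) n (β * Real.pi / 2) with hK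
  set c := Real.exp (-α * (n : ℝ) ^ r) with hc
  have hc0 : 0 < c := Real.exp_pos _
  have hKc : Continuous K := continuous_shiftedCosSeries ha hm
  have hKper : Function.Periodic K (2 * Real.pi) := periodic_shiftedCosSeries n
  have hkerper : Function.Periodic (kernel α r β) (2 * Real.pi) := by
    intro t
    rw [kernel_eq_shiftedCosSeries, kernel_eq_shiftedCosSeries]
    have := periodic_shiftedCosSeries (a := fun k => Real.exp (-α * ((k : ℝ) + 1) ^ r))
      (θ := β * Real.pi / 2) 1 t
    simpa only [Nat.cast_one] using this
  refine ENNReal.le_of_forall_pos_le_add fun ε hε _ => ?_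
  -- The tolerance becomes `ε/(2π)` after multiplication by `c/π`, hence `ε` after integration over
  -- the period.
  obtain ⟨δ, hδ, hδ1, happ⟩ := exists_abs_integral_mul_doubleBump_sub_le hKc hKper
    (ε := ε / (2 * c)) (by positivity)
  have hφ := doubleBump_mem_zeroMeanBall hδ hδ1
  have hmem : (fun x => 0 / 2 + 1 / Real.pi *
      ∫ t in (-Real.pi)..Real.pi, kernel α r β (x - t) * doubleBump δ t) ∈
      poissonClass α r β 1 :=
    ⟨periodic_convolution hkerper, 0, doubleBump δ, hφ, fun x => rfl⟩
  have hle := le_iSup₂ (f := fun f (_ : f ∈ poissonClass α r β 1) =>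
    periodNorm 1 (fun x => f x - partialFourierSum (n - 1) f x)) _ hmem
  have hrem := sub_partialFourierSum_eq_convolution (β := β) hn ha hφ
    (f := fun x => 0 / 2 + 1 / Real.pi *
      ∫ t in (-Real.pi)..Real.pi, kernel α r β (x - t) * doubleBump δ t) fun x => rfl
  simp only [hrem] at hle
  have hlow := lintegral_enorm_le_of_approx
    (w := fun x => c / Real.pi * ∫ t, K (x - t) * doubleBump δ t ∂periodMeasure)
    (H := fun x => c / (2 * Real.pi) * (K x - K (x - Real.pi))) (η := ε / (2 * Real.pi))
    fun x => by
      have e : c / Real.pi * (∫ t, K (x - t) * doubleBump δ t ∂periodMeasure) -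
          c / (2 * Real.pi) * (K x - K (x - Real.pi)) = c / Real.pi *
          ((∫ t, K (x - t) * doubleBump δ t ∂periodMeasure) -
            1 / 2 * (K x - K (x - Real.pi))) := by
        field_simp
      rw [e, abs_mul, abs_of_pos (by positivity)]
      calc c / Real.pi * _ ≤ c / Real.pi * (ε / (2 * c)) := by gcongr; exact happ x
        _ = _ := by field_simp
  have hmass : ENNReal.ofReal (ε / (2 * Real.pi)) * periodMeasure Set.univ = ε := by
    rw [periodMeasure, Measure.restrict_apply_univ, Real.volume_Ico, sub_zero,
      ← ENNReal.ofReal_mul (by positivity), div_mul_cancel₀ _ (by positivity),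
      ENNReal.ofReal_coe_nnreal]
  rw [hmass, ← ofReal_integral_norm_eq_lintegral_enorm
    (integrable_periodMeasure_of_continuous (by fun_prop))] at hlow
  simp only [norm_mul, Real.norm_of_nonneg (by positivity : 0 ≤ c / (2 * Real.pi))] at hlow
  rw [integral_const_mul] at hlow
  exact hlow.trans (add_le_add_left hle _)

end

/-! ### Comparison of the kernel with its half-period shift -/

theorem abs_le_two_of_sin {k l x : ℝ} (hk : |Real.sin (x / 2)| * |k| ≤ 1)
    (hl : |Real.sin ((x - Real.pi) / 2)| * |l| ≤ 1) : |k| ≤ 2 ∨ |l| ≤ 2 := by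
  -- Two values above `2` would force both `|sin(x/2)|` and `|cos(x/2)|` to be at most `1/2`, but
  -- their squares sum to `1`.
  by_contra! h
  have e : Real.sin ((x - Real.pi) / 2) = -Real.cos (x / 2) := by
    rw [sub_div, Real.sin_sub_pi_div_two]
  rw [e, abs_neg] at hl
  have h1 : |Real.sin (x / 2)| ≤ 1 / 2 := by nlinarith [abs_nonneg (Real.sin (x / 2))]
  have h2 : |Real.cos (x / 2)| ≤ 1 / 2 := by nlinarith [abs_nonneg (Real.cos (x / 2))]
  have h3 := Real.sin_sq_add_cos_sq (x / 2)
  rw [← sq_abs (Real.sin _), ← sq_abs (Real.cos _)] at h3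
  nlinarith [abs_nonneg (Real.sin (x / 2)), abs_nonneg (Real.cos (x / 2))]

theorem abs_add_abs_sub_four_le {k l : ℝ} (h : |k| ≤ 2 ∨ |l| ≤ 2) :
    |k| + |l| - 4 ≤ |k - l| := by
  have h1 := abs_sub_abs_le_abs_sub k l
  have h2 := abs_sub_abs_le_abs_sub l k
  rw [abs_sub_comm l k] at h2
  rcases h with h | h <;> linarith

/-- At each point one of the two values is at most `2` in modulus, so the difference loses at most
`4` against the sum of the moduli; `8π` is `4` times the period. -/
theorem integral_abs_sub_shift_ge {a : ℕ → ℝ} {θ : ℝ} {n : ℕ} (ha : Summable a)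
    (hm : Antitone a) (ha0 : a 0 = 1) :
    2 * (∫ t in (-Real.pi)..Real.pi, |shiftedCosSeries a n θ t|) - 8 * Real.pi ≤
      ∫ x, |(shiftedCosSeries a n θ x - shiftedCosSeries a n θ (x - Real.pi))|
        ∂periodMeasure := by
  set K := shiftedCosSeries a n θ
  have hKc : Continuous K := continuous_shiftedCosSeries ha hm
  have hKper : Function.Periodic K (2 * Real.pi) := periodic_shiftedCosSeries n
  have habs : Function.Periodic (fun t => |K t|) (2 * Real.pi) := fun x => by simp only [hKper x]
  have hshift := integral_periodMeasure_comp_add habs (-Real.pi)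
  simp only [← sub_eq_add_neg] at hshift
  have i1 : Integrable (fun x => |K x|) periodMeasure :=
    integrable_periodMeasure_of_continuous (by fun_prop)
  have i2 : Integrable (fun x => |K (x - Real.pi)|) periodMeasure :=
    integrable_periodMeasure_of_continuous (by fun_prop)
  have hmono := integral_mono (μ := periodMeasure)
    (f := fun x => |K x| + |K (x - Real.pi)| - 4) (g := fun x => |K x - K (x - Real.pi)|)
    ((i1.add i2).sub (integrable_const _))
    (integrable_periodMeasure_of_continuous (by fun_prop)) fun x =>
      abs_add_abs_sub_four_le (abs_le_two_of_sin (x := x)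
        ((abs_shiftedCosSeries_mul_sin_le ha hm _).trans ha0.le)
        ((abs_shiftedCosSeries_mul_sin_le ha hm _).trans ha0.le))
  refine le_trans (le_of_eq ?_) hmono
  have hmass : periodMeasure.real Set.univ = 2 * Real.pi := by
    rw [periodMeasure, measureReal_restrict_apply_univ, Real.volume_real_Ico_of_le (by positivity),
      sub_zero]
  rw [integral_sub (i1.fun_add i2) (integrable_const _), integral_add i1 i2, hshift, integral_const,
    hmass, integral_neg_pi_pi_eq habs, smul_eq_mul]
  ring

end GenPoisson

/-! ### The asymptotic formula -/

theorem mainTheorem3 (α r β : ℝ) (hα : 0 < α) (hr0 : 0 < r) (hr1 : r < 1)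
    (n : ℕ) (hn : GenPoisson.n₁ α r ≤ n) :
    GenPoisson.fourierError n α r β 1 1 ≠ ∞ ∧
    ∃ γ : ℝ, |γ| ≤ 20 * Real.pi ^ 4 ∧
      (GenPoisson.fourierError n α r β 1 1).toReal =
        4 / Real.pi ^ 2 * Real.exp (-α * (n : ℝ) ^ r) *
            Real.log (Real.pi * (n : ℝ) ^ (1 - r) / (α * r)) +
          γ * Real.exp (-α * (n : ℝ) ^ r) := by
  open GenPoisson in
  have hpi := Real.pi_pos
  obtain ⟨hn0, hB, hρ1⟩ := two_le_and_le_one_of_n₁_le hα hr0 hr1 hn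
  have hn0' : (0 : ℝ) < n := by exact_mod_cast hn0
  have hm := antitone_normalizedCoeff (n := n) hα.le hr0.le
  have ha := summable_normalizedCoeff hα.le hr0.le hn0 hB
  have ha0 := normalizedCoeff_zero (α := α) (r := r) (n := n)
  have hup := fourierError_le (β := β) hn0 ha hm
  have hlow := le_fourierError (β := β) hn0 ha hm
  have hρ0 : 0 < α * r / (n : ℝ) ^ (1 - r) := by positivity
  -- Since `n ρ = α r n^r ≥ 2` and `ρ ≤ 1`, the product is at least `3/2`.
  have hw : 1 ≤ ((n : ℝ) - 1 / 2) * (α * r / (n : ℝ) ^ (1 - r)) := by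
    have e : α * r * (n : ℝ) ^ r = n * (α * r / (n : ℝ) ^ (1 - r)) := by
      rw [Real.rpow_sub hn0', Real.rpow_one]
      field_simp
    rw [e] at hB
    linarith
  have hL := abs_integral_abs_shiftedCosSeries_sub_le (m := n) (θ := β * Real.pi / 2) ha hm
    (antitone_normalizedCoeff_sub hα.le hr0.le hr1.le) ha0
    (normalizedCoeff_zero_sub_one_le hα.le hr0.le hr1.le hn0) hρ0 hρ1
    (tsum_normalizedCoeff_le hα.le hr0.le hn0 hB hρ1) hw
  have hH := integral_abs_sub_shift_ge (θ := β * Real.pi / 2) (n := n) ha hm ha0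
  have elog : Real.pi / (α * r / (n : ℝ) ^ (1 - r)) =
      Real.pi * (n : ℝ) ^ (1 - r) / (α * r) := by
    field_simp
  rw [elog] at hL
  set E := fourierError n α r β 1 1
  set c := Real.exp (-α * (n : ℝ) ^ r)
  have hc0 : 0 < c := Real.exp_pos _
  set L := Real.log (Real.pi * (n : ℝ) ^ (1 - r) / (α * r))
  set I := ∫ t in (-Real.pi)..Real.pi,
    |shiftedCosSeries (normalizedCoeff α r n) n (β * Real.pi / 2) t|
  have hI0 : 0 ≤ I := intervalIntegral.integral_nonneg (by linarith) fun t _ => abs_nonneg _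
  have hfin : E ≠ ∞ := ne_top_of_le_ne_top ENNReal.ofReal_ne_top hup
  refine ⟨hfin, (E.toReal - 4 / Real.pi ^ 2 * c * L) / c, ?_, ?_⟩
  · have h1 : E.toReal ≤ c / Real.pi * I := ENNReal.toReal_le_of_le_ofReal (by positivity) hup
    have h2 : c / (2 * Real.pi) * (2 * I - 8 * Real.pi) ≤ E.toReal :=
      (mul_le_mul_of_nonneg_left hH (by positivity)).trans
        ((ENNReal.ofReal_le_iff_le_toReal hfin).1 hlow)
    have e2 : c / (2 * Real.pi) * (2 * I - 8 * Real.pi) = c / Real.pi * I - 4 * c := by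
      field_simp
      ring
    have e3 : 4 / Real.pi ^ 2 * c * L = c / Real.pi * (4 / Real.pi * L) := by
      field_simp
    have h3 : |c / Real.pi * I - 4 / Real.pi ^ 2 * c * L| ≤ 18 * c := by
      rw [e3, ← mul_sub, abs_mul, abs_of_pos (by positivity)]
      calc c / Real.pi * _ ≤ c / Real.pi * 36 := by gcongr
        _ ≤ c / 2 * 36 := by gcongr; exact Real.two_le_pi
        _ = 18 * c := by ring
    -- The total error is `18 c` from the norm of the kernel (`36/π ≤ 18`) plus `4 c` from the gap
    -- between the upper and lower bounds.
    have h4 : (22 : ℝ) ≤ 20 * Real.pi ^ 4 := by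
      have : (2 : ℝ) ^ 4 ≤ Real.pi ^ 4 := by gcongr; exact Real.two_le_pi
      linarith
    rw [abs_div, abs_of_pos hc0, div_le_iff₀ hc0]
    refine le_trans ?_ (mul_le_mul_of_nonneg_right h4 hc0.le)
    rw [abs_le] at h3 ⊢
    constructor <;> linarith
  · rw [div_mul_cancel₀ _ hc0.ne']
    ring
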